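/- Let $(M,c)$ be a smooth manifold of dimension $n\ge 3$ with a conformal structure of positive definite signature, i.e. a class $c$ of Riemannian metrics, any two of which differ by the square of a positive smooth function. Let $\gamma\colon J\to M$ be a smooth regular curve on an open interval $J$, with tangent vector $U$ and $u=\sqrt{\langle U,U\rangle}$. For $g\in c$ write $\langle\cdot,\cdot\rangle$ for the inner product, $\nabla$ for the Levi-Civita connection, $\mathsf P=\frac1{n-2}\big(\mathrm{Ric}-\frac{\mathrm{Scal}}{2(n-1)}g\big)$ for the Schouten tensor, and $U'=\nabla_UU$, $U''=\nabla_UU'$. In the scale $g$ the standard tractor bundle is $\mathcal T=\mathbb R\oplus TM\oplus\mathbb R$, with the tractor metric $\langle(\sigma,\mu,\rho),(\tau,\nu,\pi)\rangle=\langle\mu,\nu\rangle+\sigma\pi+\rho\tau$ and the tractor connection, along the curve, $$\frac{d}{dt}(\sigma,\mu,\rho)=\big(\sigma'-\langle U,\mu\rangle,\ \nabla_U\mu+\rho\,U+\sigma\,\mathsf P(U)^\sharp,\ \rho'-\mathsf P(U,\mu)\big).$$ Put $\mathbf T=(0,0,u^{-1})$, $\mathbf U=\frac{d}{dt}\mathbf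 T$, $\mathbf U'=\frac{d}{dt}\mathbf U$, $\mathbf U''=\frac{d}{dt}\mathbf U'$. Then the following conditions are equivalent, where each of them may be evaluated in any metric $g$ of the conformal class, not necessarily the same one for the three conditions: (a) the curve is a conformal circle with an arbitrary parametrization, i.e. near each of its points it has a smooth regular reparametrization that solves $$U''=3u^{-2}\langle U,U'\rangle U'-\tfrac32u^{-2}\langle U',U'\rangle U+u^2\,\mathsf P(U)^\sharp-2\,\mathsf P(U,U)\,U;$$ (b) all points of the curve are vertices, i.e. $\Phi=\langle\mathbf U'',\mathbf U''\rangle-\langle\mathbf U',\mathbf U'\rangle^2$ vanishes identically on $J$; (c) $\mathrm{span}(\mathbf T,\mathbf U,\mathbf U')\subset\mathcal T$ has rank 3 and is parallel along the curve, i.e. the derivative $\frac{d}{dt}$ of each smooth section of it along the curve is again a section of it. -/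

import Mathlib

open Set Bundle
open scoped Manifold ContDiff

noncomputable section

namespace ConformalCurves

/-- The model space `ℝⁿ` of an `n`-dimensional manifold. -/
abbrev Model (n : ℕ) : Type := EuclideanSpace ℝ (Fin n)

/-! ### Coordinate formulas on (an open part of) `ℝⁿ`

Here `G y` is the metric at the point with coordinates `y`, as a map `v ↦ G y v ·`. -/

/-- The Christoffel symbols as a bilinear expression: `Γ(v,w)` is the vector with
`G (Γ(v,w), z) = ½ (∂_v G(w,z) + ∂_w G(v,z) - ∂_z G(v,w))` for all `z`. -/
def christoffel {n : ℕ} (G : Model n → Model n →L[ℝ] Model n →L[ℝ] ℝ)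
    (y v w : Model n) : Model n :=
  (1 / 2 : ℝ) • (G y).inverse
    (fderiv ℝ G y v w + fderiv ℝ G y w v - ((fderiv ℝ G y).flip v).flip w)

/-- The Riemann curvature `R(u,v)w = ∇_u ∇_v w - ∇_v ∇_u w` on constant coordinate fields. -/
def riemann {n : ℕ} (G : Model n → Model n →L[ℝ] Model n →L[ℝ] ℝ)
    (y u v w : Model n) : Model n :=
  fderiv ℝ (fun z => christoffel G z v w) y u - fderiv ℝ (fun z => christoffel G z u w) y v
    + christoffel G y u (christoffel G y v w) - christoffel G y v (christoffel G y u w)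

/-- The Ricci tensor `Ric(v,w) = trace (u ↦ R(u,v)w)`. -/
def ricci {n : ℕ} (G : Model n → Model n →L[ℝ] Model n →L[ℝ] ℝ) (y v w : Model n) : ℝ :=
  ∑ i, riemann G y (EuclideanSpace.single i 1) v w i

/-- The vector `Gⁱʲ eᵢ`, for fixed `j`: the `j`-th coordinate covector with its index raised. -/
def raisedCoord {n : ℕ} (G : Model n → Model n →L[ℝ] Model n →L[ℝ] ℝ)
    (y : Model n) (j : Fin n) : Model n :=
  (G y).inverse (EuclideanSpace.proj j)

/-- The scalar curvature `Gⁱʲ Ricᵢⱼ`. -/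
def scalarCurv {n : ℕ} (G : Model n → Model n →L[ℝ] Model n →L[ℝ] ℝ) (y : Model n) : ℝ :=
  ∑ j, ∑ i, raisedCoord G y j i *
    ricci G y (EuclideanSpace.single i 1) (EuclideanSpace.single j 1)

/-- The Schouten tensor `P = (Ric - Scal / (2(n-1)) G) / (n-2)`, for `n ≥ 3`. -/
def schoutenCoord {n : ℕ} (G : Model n → Model n →L[ℝ] Model n →L[ℝ] ℝ)
    (y v w : Model n) : ℝ :=
  (ricci G y v w - scalarCurv G y / (2 * ((n : ℝ) - 1)) * G y v w) / ((n : ℝ) - 2)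

/-- The vector `vᵃ Pₐᵇ`. -/
def schoutenSharpCoord {n : ℕ} (G : Model n → Model n →L[ℝ] Model n →L[ℝ] ℝ)
    (y v : Model n) : Model n :=
  ∑ j, schoutenCoord G y v (EuclideanSpace.single j 1) • raisedCoord G y j

/-! ### Riemannian metrics and conformal structures -/

section Manifold

variable {n : ℕ} {M : Type*} [TopologicalSpace M] [ChartedSpace (Model n) M]
  [IsManifold (𝓡 n) ∞ M]

variable (n M) in
/-- A smooth Riemannian metric on the `n`-manifold `M`. -/
abbrev Metric : Type _ :=
  ContMDiffRiemannianMetric (𝓡 n) ∞ (Model n) (fun x : M => TangentSpace (𝓡 n) x)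

/-- `g'` is conformal to `g`: `g' = Ω² g` for an everywhere positive smooth function `Ω`. -/
def IsConformalTo (g' g : Metric n M) : Prop :=
  ∃ Ω : M → ℝ, ContMDiff (𝓡 n) 𝓘(ℝ, ℝ) ∞ Ω ∧ (∀ x, 0 < Ω x) ∧
    ∀ (x : M) (v w : TangentSpace (𝓡 n) x), g'.inner x v w = Ω x ^ 2 * g.inner x v w

variable (n M) in
/-- A conformal structure of positive definite signature: a conformal class of Riemannian
metrics. -/
structure ConformalStructure where
  metrics : Set (Metric n M)
  nonempty : metrics.Nonempty
  mem_iff : ∀ g ∈ metrics, ∀ g' : Metric n M, g' ∈ metrics ↔ IsConformalTo g' g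

/-- The metric in the chart centred at `p`: the pull-back of `g` under the inverse chart. -/
def coordMetric (g : Metric n M) (p : M) (y : Model n) : Model n →L[ℝ] Model n →L[ℝ] ℝ :=
  let x : M := (extChartAt (𝓡 n) p).symm y
  let A : Model n →L[ℝ] Model n := mfderiv 𝓘(ℝ, Model n) (𝓡 n) (extChartAt (𝓡 n) p).symm y
  let gx : Model n →L[ℝ] Model n →L[ℝ] ℝ := g.inner x
  gx.bilinearComp A A

/- A tangent vector at `x` is, in Mathlib, its coordinate vector in the chart centred at `x`.
So tensors at `x` are given by the coordinate formulas in that chart. -/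

/-- The Schouten tensor `P(v,w)` of `g` at `x`. -/
def schouten (g : Metric n M) (x : M) (v w : TangentSpace (𝓡 n) x) : ℝ :=
  schoutenCoord (coordMetric g x) (extChartAt (𝓡 n) x x) v w

/-- The vector `vᵃ Pₐᵇ` at `x`, the index being raised by `g`. -/
def schoutenSharp (g : Metric n M) (x : M) (v : TangentSpace (𝓡 n) x) : TangentSpace (𝓡 n) x :=
  schoutenSharpCoord (coordMetric g x) (extChartAt (𝓡 n) x x) v

/-! ### Curves -/

/-- The tangent vector `U` of a parametrized curve. -/
def velocity (γ : ℝ → M) (t : ℝ) : TangentSpace (𝓡 n) (γ t) :=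
  mfderiv 𝓘(ℝ, ℝ) (𝓡 n) γ t (1 : ℝ)

/-- The covariant derivative `Uᶜ∇_c V` along `γ` of a vector field `V` along `γ`, for the
Levi-Civita connection of `g`: at the parameter `t`, in the chart centred at `γ t`, it is
`dV/dt + Γ(U, V)`. -/
def covDeriv (g : Metric n M) (γ : ℝ → M) (V : ∀ t, TangentSpace (𝓡 n) (γ t)) (t : ℝ) :
    TangentSpace (𝓡 n) (γ t) :=
  let V' : Model n :=
    deriv (fun s => (mfderiv (𝓡 n) 𝓘(ℝ, Model n) (extChartAt (𝓡 n) (γ t)) (γ s) (V s) :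
      Model n)) t
  let C : Model n :=
    christoffel (coordMetric g (γ t)) (extChartAt (𝓡 n) (γ t) (γ t)) (velocity γ t) (V t)
  V' + C

/-- The parametrized curve `γ` solves, at the parameter `t`, the conformal circle equation
`U'' = 3u⁻²⟨U,U'⟩U' - (3/2)u⁻²⟨U',U'⟩U + u² UᶜP_cᵃ - 2P(U,U)U`, where `u² = ⟨U,U⟩`. -/
def SolvesCircleEquationAt (g : Metric n M) (γ : ℝ → M) (t : ℝ) : Prop :=
  let ip := g.inner (γ t)
  let U := velocity (n := n) γ t
  let U' := covDeriv g γ (velocity γ) t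
  let U'' := covDeriv g γ (covDeriv g γ (velocity γ)) t
  U'' = (3 * (ip U U)⁻¹ * ip U U') • U' - (3 / 2 * (ip U U)⁻¹ * ip U' U') • U
    + ip U U • schoutenSharp g (γ t) U - (2 * schouten g (γ t) U U) • U

/-- The curve `γ` on the interval `J` is a conformal circle, arbitrarily parametrized: near each
`t₀ ∈ J` there is a smooth regular change of parameter `t = h τ` such that the reparametrized curve
`γ ∘ h` solves the conformal circle equation. -/
def IsConformalCircle (g : Metric n M) (γ : ℝ → M) (J : Set ℝ) : Prop :=
  ∀ t₀ ∈ J, ∃ (K : Set ℝ) (h : ℝ → ℝ), IsOpen K ∧ K.OrdConnected ∧ ContDiffOn ℝ ∞ h K ∧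
    (∀ τ ∈ K, deriv h τ ≠ 0) ∧ MapsTo h K J ∧ t₀ ∈ h '' K ∧
    ∀ τ ∈ K, SolvesCircleEquationAt g (γ ∘ h) τ

/-! ### Tractors

In the scale given by a metric `g` of the conformal class, densities are functions and the standard
tractor bundle is `ℝ ⊕ TM ⊕ ℝ`, with elements `(σ, μ, ρ)`. For the metric `Ω² g` the same tractor
has the components `(Ωσ, Ω⁻¹(μ + σΥ♯), Ω⁻¹(ρ - Υ(μ) - ½|Υ|²σ))`, where `Υ = d log Ω`. -/

variable (n) in
/-- The fibre at `x` of the standard tractor bundle, in a given scale. -/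
abbrev Tractor (x : M) : Type := ℝ × TangentSpace (𝓡 n) x × ℝ

/-- The tractor metric `⟨(σ,μ,ρ), (τ,ν,π)⟩ = g(μ,ν) + σπ + ρτ`. -/
def tractorMetric (g : Metric n M) (x : M) (V W : Tractor n x) : ℝ :=
  g.inner x V.2.1 W.2.1 + V.1 * W.2.2 + V.2.2 * W.1

/-- The derivative along `γ` of a section of the tractor bundle along `γ`, for the standard tractor
connection: `(σ' - g(U,μ), μ' + ρ U + σ UᶜP_cᵃ, ρ' - P(U,μ))`. -/
def tractorDeriv (g : Metric n M) (γ : ℝ → M) (W : ∀ t, Tractor n (γ t)) (t : ℝ) :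
    Tractor n (γ t) :=
  let U := velocity (n := n) γ t
  (deriv (fun s => (W s).1) t - g.inner (γ t) U (W t).2.1,
    covDeriv g γ (fun s => (W s).2.1) t + (W t).2.2 • U + (W t).1 • schoutenSharp g (γ t) U,
    deriv (fun s => (W s).2.2) t - schouten g (γ t) U (W t).2.1)

/-- The canonical lift `T = (0, 0, u⁻¹)`, where `u = √⟨U,U⟩`. -/
def tractorT (g : Metric n M) (γ : ℝ → M) (t : ℝ) : Tractor n (γ t) :=
  (0, 0, (√(g.inner (γ t) (velocity γ t) (velocity γ t)))⁻¹)

/-- `tractorU g γ i` is the `i`-th derivative `U⁽ⁱ⁾` of the tractor `U = dT/dt`. -/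
def tractorU (g : Metric n M) (γ : ℝ → M) : ℕ → ∀ t, Tractor n (γ t)
  | 0 => tractorDeriv g γ (tractorT g γ)
  | i + 1 => tractorDeriv g γ (tractorU g γ i)

/-- `Φ = ⟨U'',U''⟩ - ⟨U',U'⟩²`. A point of the curve is a vertex if `Φ = 0` there. -/
def Phi (g : Metric n M) (γ : ℝ → M) (t : ℝ) : ℝ :=
  tractorMetric g (γ t) (tractorU g γ 2 t) (tractorU g γ 2 t)
    - tractorMetric g (γ t) (tractorU g γ 1 t) (tractorU g γ 1 t) ^ 2

/-- Smooth sections over `J` of the tractor bundle along `γ`. -/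
def IsSmoothTractorAlong (γ : ℝ → M) (J : Set ℝ) (W : ∀ t, Tractor n (γ t)) : Prop :=
  ContDiffOn ℝ ∞ (fun t => (W t).1) J ∧
  ContMDiffOn 𝓘(ℝ, ℝ) (𝓡 n).tangent ∞
    (fun t => (⟨γ t, (W t).2.1⟩ : TangentBundle (𝓡 n) M)) J ∧
  ContDiffOn ℝ ∞ (fun t => (W t).2.2) J

/-- The span of `T, U, U'` at the parameter `t`. -/
def osculatingSpan (g : Metric n M) (γ : ℝ → M) (t : ℝ) : Submodule ℝ (Tractor n (γ t)) :=
  Submodule.span ℝ {tractorT g γ t, tractorU g γ 0 t, tractorU g γ 1 t}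

/-- The spans of `T, U, U'` have dimension 3, and the subbundle they form is parallel along the
curve: the derivative of each of its smooth sections is again a section of it. -/
def OsculatingBundleIsParallel (g : Metric n M) (γ : ℝ → M) (J : Set ℝ) : Prop :=
  (∀ t ∈ J, Module.finrank ℝ (osculatingSpan g γ t) = 3) ∧
  ∀ W : ∀ t, Tractor n (γ t), IsSmoothTractorAlong γ J W →
    (∀ t ∈ J, W t ∈ osculatingSpan g γ t) →
    ∀ t ∈ J, tractorDeriv g γ W t ∈ osculatingSpan g γ t

end Manifold

end ConformalCurves

end

noncomputable section

namespace ConformalCurves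

set_option synthInstance.maxHeartbeats 400000

/-! All three conditions say that one vector field along the curve, N = U'' - 3u⁻²⟨U,U'⟩U' - u²
P(U)♯ (`obstruction`), is everywhere tangent to the curve (`IsTangential`).

Conformal invariance (`IsRescaling.obstruction`): for g' = Ω²g, with Y the gradient of log Ω, the
fields U', U'' and P(U)♯ change by terms in U, U', Y and ∇_U Y. In N the last three kinds cancel, so
N changes only by a multiple of U. Tangency of N therefore does not depend on the metric of the
class, and each condition can be compared with it in its own scale.

Circles (`isConformalCircle_iff_isTangential`): for γ ∘ h the circle equation reads h'³N + (h''' -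
(3/2)h''²/h' + h'³(...))U = 0. The part of N normal to U is only rescaled by h and has to vanish. If
it does, the U-coefficient is a third-order ODE for h, solvable near any point.

Tractors (`tractorU_two`): differentiating T three times gives (0, u⁻¹N + κU, ρ). Its pairing with
the second tractor, whose middle entry is the unit tangent, is -⟨U',U'⟩, so Φ is the squared length
of u⁻¹N minus that of its tangential part: Φ = u⁻²|N^⊥|² (`Phi_eq`). In the span of T, U, U' only U'
has a nonzero first entry, so an element with first entry zero has the form (0, aU, b). Hence the
derivative of U' stays in the span exactly when N is tangent (`osculatingBundleIsParallel_iff`).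

The remaining work is classical: curvature in coordinates is natural under chart changes, so tensors
defined in the chart centred at each point can be differentiated in one fixed chart, and the
Schouten tensor obeys its usual conformal transformation law. -/

instance {n : ℕ} : NormedAddCommGroup (Model n →L[ℝ] ℝ) := inferInstance
instance {n : ℕ} : NormedSpace ℝ (Model n →L[ℝ] ℝ) := inferInstance
instance {n : ℕ} : NormedAddCommGroup (Model n →L[ℝ] Model n) := inferInstance
instance {n : ℕ} : NormedSpace ℝ (Model n →L[ℝ] Model n) := inferInstance
instance {n : ℕ} : NormedAddCommGroup (Model n →L[ℝ] Model n →L[ℝ] ℝ) := inferInstance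
instance {n : ℕ} : NormedSpace ℝ (Model n →L[ℝ] Model n →L[ℝ] ℝ) := inferInstance
instance {n : ℕ} : NormedAddCommGroup (Model n →L[ℝ] Model n →L[ℝ] Model n) := inferInstance
instance {n : ℕ} : NormedSpace ℝ (Model n →L[ℝ] Model n →L[ℝ] Model n) := inferInstance
instance {n : ℕ} : AddCommGroup (Model n →L[ℝ] ℝ) := inferInstance
instance {n : ℕ} : AddCommGroup (Model n →L[ℝ] Model n) := inferInstance
instance {n : ℕ} : AddCommGroup (Model n →L[ℝ] Model n →L[ℝ] ℝ) := inferInstance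
instance {n : ℕ} : AddCommGroup (Model n →L[ℝ] Model n →L[ℝ] Model n) := inferInstance

/-! ### Levi-Civita connection and curvature of a metric on an open subset of ℝⁿ -/

/-- `G` restricts to a smooth Riemannian metric on the open set `s`. -/
structure IsMetricOn {n : ℕ} (G : Model n → Model n →L[ℝ] Model n →L[ℝ] ℝ)
    (s : Set (Model n)) : Prop where
  isOpen : IsOpen s
  smooth : ContDiffOn ℝ ∞ G s
  symm : ∀ y ∈ s, ∀ v w, G y v w = G y w v
  pos : ∀ y ∈ s, ∀ v, v ≠ 0 → 0 < G y v v

/-- Definiteness makes `B` injective into the dual, which has the same dimension. This is what gives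
the total function `inverse` its meaning. -/
lemma isInvertible_of_pos {n : ℕ} {B : Model n →L[ℝ] Model n →L[ℝ] ℝ}
    (hB : ∀ v, v ≠ 0 → 0 < B v v) : B.IsInvertible := by
  have hinj : Function.Injective B.toLinearMap := by
    rw [← LinearMap.ker_eq_bot, LinearMap.ker_eq_bot']
    intro v hv
    by_contra h
    have h1 := hB v h
    have h2 : B v = 0 := hv
    simp [h2] at h1
  have hfin : Module.finrank ℝ (Model n) = Module.finrank ℝ (Model n →L[ℝ] ℝ) := by
    rw [← (LinearMap.toContinuousLinearMap (𝕜 := ℝ) (E := Model n) (F' := ℝ)).finrank_eq]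
    exact (Subspace.dual_finrank_eq (K := ℝ) (V := Model n)).symm
  let e := LinearMap.linearEquivOfInjective B.toLinearMap hinj hfin
  refine ⟨e.toContinuousLinearEquiv, ?_⟩
  ext v w
  simp [e]

section Basic

variable {n : ℕ} {G : Model n → Model n →L[ℝ] Model n →L[ℝ] ℝ} {s : Set (Model n)}

lemma IsMetricOn.isInvertible (hG : IsMetricOn G s) {y : Model n} (hy : y ∈ s) :
    (G y).IsInvertible :=
  isInvertible_of_pos (hG.pos y hy)

lemma IsMetricOn.apply_inverse (hG : IsMetricOn G s) {y : Model n} (hy : y ∈ s)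
    (φ : Model n →L[ℝ] ℝ) (v : Model n) : G y ((G y).inverse φ) v = φ v := by
  obtain ⟨e, he⟩ := hG.isInvertible hy
  rw [← he]
  simp

/-- Nondegeneracy as an extensionality principle: vectors defined through `inverse` are identified
by their pairings alone. -/
lemma IsMetricOn.ext_left (hG : IsMetricOn G s) {y : Model n} (hy : y ∈ s) {v w : Model n}
    (h : ∀ z, G y v z = G y w z) : v = w := by
  by_contra hne
  have := hG.pos y hy (v - w) (sub_ne_zero.2 hne)
  rw [map_sub (G y), sub_apply, h, sub_self] at this
  exact lt_irrefl _ this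

lemma IsMetricOn.contDiffAt (hG : IsMetricOn G s) {y : Model n} (hy : y ∈ s) :
    ContDiffAt ℝ ∞ G y :=
  hG.smooth.contDiffAt (hG.isOpen.mem_nhds hy)

lemma IsMetricOn.hasFDerivAt (hG : IsMetricOn G s) {y : Model n} (hy : y ∈ s) :
    HasFDerivAt G (fderiv ℝ G y) y :=
  ((hG.contDiffAt hy).differentiableAt (by simp)).hasFDerivAt

lemma IsMetricOn.contDiffAt_inverse (hG : IsMetricOn G s) {y : Model n} (hy : y ∈ s) :
    ContDiffAt ℝ ∞ (fun z => (G z).inverse) y :=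
  (hG.isInvertible hy).contDiffAt_map_inverse.comp y (hG.contDiffAt hy)

lemma IsMetricOn.fderiv_symm (hG : IsMetricOn G s) {y : Model n} (hy : y ∈ s)
    (u v w : Model n) : fderiv ℝ G y u v w = fderiv ℝ G y u w v := by
  have h := hG.hasFDerivAt hy
  have h1 := (h.clm_apply (hasFDerivAt_const v y)).clm_apply (hasFDerivAt_const w y)
  have h2 := (h.clm_apply (hasFDerivAt_const w y)).clm_apply (hasFDerivAt_const v y)
  have h3 := h2.congr_of_eventuallyEq (f₁ := fun z => G z v w) <| by
    filter_upwards [hG.isOpen.mem_nhds hy] with z hz using hG.symm z hz v w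
  have := congrArg (fun L => L u) (h1.unique h3)
  simpa using this

/-- The Christoffel symbols as a bilinear map. -/
def christoffelCLM (G : Model n → Model n →L[ℝ] Model n →L[ℝ] ℝ) (y : Model n) :
    Model n →L[ℝ] Model n →L[ℝ] Model n :=
  (1 / 2 : ℝ) • (ContinuousLinearMap.compL ℝ (Model n) (Model n →L[ℝ] ℝ) (Model n)
    (G y).inverse).comp (fderiv ℝ G y + (fderiv ℝ G y).flip
      - (ContinuousLinearMap.flipₗᵢ ℝ (Model n) (Model n) ℝ).toContinuousLinearEquiv.toContinuousLinearMap.comp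
        (fderiv ℝ G y).flip)

lemma christoffelCLM_apply (y v w : Model n) :
    christoffelCLM G y v w = christoffel G y v w := by
  simp [christoffelCLM, christoffel]

lemma IsMetricOn.contDiffAt_christoffelCLM (hG : IsMetricOn G s) {y : Model n} (hy : y ∈ s) :
    ContDiffAt ℝ ∞ (christoffelCLM G) y := by
  have h1 := hG.contDiffAt_inverse hy
  have h2 : ContDiffAt ℝ ∞ (fderiv ℝ G) y := (hG.contDiffAt hy).fderiv_right (by simp)
  have h3 : ContDiffAt ℝ ∞ (fun z => (fderiv ℝ G z).flip) y :=
    (ContinuousLinearMap.flipₗᵢ ℝ (Model n) (Model n)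
      (Model n →L[ℝ] ℝ)).contDiff.contDiffAt.comp y h2
  have h4 := (ContinuousLinearMap.compL ℝ (Model n) (Model n →L[ℝ] ℝ)
    (Model n)).contDiff.contDiffAt.comp y h1
  exact (h4.clm_comp ((h2.add h3).sub (contDiffAt_const.clm_comp h3))).const_smul (1 / 2 : ℝ)

lemma IsMetricOn.hasFDerivAt_christoffelCLM (hG : IsMetricOn G s) {y : Model n} (hy : y ∈ s) :
    HasFDerivAt (christoffelCLM G) (fderiv ℝ (christoffelCLM G) y) y :=
  ((hG.contDiffAt_christoffelCLM hy).differentiableAt (by simp)).hasFDerivAt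

lemma IsMetricOn.koszul (hG : IsMetricOn G s) {y : Model n} (hy : y ∈ s) (v w z : Model n) :
    G y (christoffelCLM G y v w) z =
      1 / 2 * (fderiv ℝ G y v w z + fderiv ℝ G y w v z - fderiv ℝ G y z v w) := by
  rw [christoffelCLM_apply, christoffel, map_smul, smul_apply,
    hG.apply_inverse hy]
  simp

lemma IsMetricOn.christoffel_symm (hG : IsMetricOn G s) {y : Model n} (hy : y ∈ s)
    (v w : Model n) : christoffelCLM G y v w = christoffelCLM G y w v := by
  refine hG.ext_left hy fun z => ?_
  rw [hG.koszul hy, hG.koszul hy, hG.fderiv_symm hy z v w]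
  ring

/-- In the sum of the two Koszul formulas the derivatives of `G` along `v` and `w` cancel, and the
derivative along `u` appears twice with the factor 1/2. -/
lemma IsMetricOn.compatible (hG : IsMetricOn G s) {y : Model n} (hy : y ∈ s) (u v w : Model n) :
    fderiv ℝ G y u v w =
      G y (christoffelCLM G y u v) w + G y v (christoffelCLM G y u w) := by
  rw [hG.symm y hy v, hG.koszul hy, hG.koszul hy, hG.fderiv_symm hy v u w,
    hG.fderiv_symm hy u w v, hG.fderiv_symm hy w u v]
  ring

/-- The curvature of a connection with the symbols `Γ`. -/
def curv (Γ : Model n → Model n →L[ℝ] Model n →L[ℝ] Model n) (y u v w : Model n) : Model n :=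
  fderiv ℝ Γ y u v w - fderiv ℝ Γ y v u w + Γ y u (Γ y v w) - Γ y v (Γ y u w)

lemma IsMetricOn.riemann_eq (hG : IsMetricOn G s) {y : Model n} (hy : y ∈ s) (u v w : Model n) :
    riemann G y u v w = curv (christoffelCLM G) y u v w := by
  have h := hG.hasFDerivAt_christoffelCLM hy
  have key : ∀ a b c : Model n, fderiv ℝ (fun z => christoffel G z a b) y c =
      fderiv ℝ (christoffelCLM G) y c a b := by
    intro a b c
    have h1 := (h.clm_apply (hasFDerivAt_const a y)).clm_apply (hasFDerivAt_const b y)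
    simp only [christoffelCLM_apply] at h1
    rw [h1.fderiv]
    simp
  simp only [riemann, curv, key, christoffelCLM_apply]

lemma sum_single_apply_mul (φ : Model n →ₗ[ℝ] ℝ) (v : Model n) :
    ∑ i, φ (EuclideanSpace.single i 1) * v i = φ v := by
  conv_rhs => rw [← (EuclideanSpace.basisFun (Fin n) ℝ).sum_repr v]
  simp [mul_comm]

lemma trace_eq_sum_single (L : Model n →ₗ[ℝ] Model n) :
    LinearMap.trace ℝ (Model n) L = ∑ i, L (EuclideanSpace.single i 1) i := by
  rw [LinearMap.trace_eq_matrix_trace ℝ (EuclideanSpace.basisFun (Fin n) ℝ).toBasis]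
  simp [Matrix.trace, LinearMap.toMatrix_apply]

/-- The Ricci tensor as a bilinear map. -/
def ricciLin (Γ : Model n → Model n →L[ℝ] Model n →L[ℝ] Model n) (y : Model n) :
    Model n →ₗ[ℝ] Model n →ₗ[ℝ] ℝ :=
  LinearMap.mk₂ ℝ (fun v w => ∑ i, curv Γ y (EuclideanSpace.single i 1) v w i)
    (fun a b c => by rw [← Finset.sum_add_distrib]; congr 1; ext i; simp [curv]; ring)
    (fun r a b => by rw [Finset.smul_sum]; congr 1; ext i; simp [curv]; ring)
    (fun a b c => by rw [← Finset.sum_add_distrib]; congr 1; ext i; simp [curv]; ring)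
    (fun r a b => by rw [Finset.smul_sum]; congr 1; ext i; simp [curv]; ring)

lemma IsMetricOn.ricci_eq (hG : IsMetricOn G s) {y : Model n} (hy : y ∈ s) (v w : Model n) :
    ricci G y v w = ricciLin (christoffelCLM G) y v w := by
  simp [ricci, ricciLin, hG.riemann_eq hy]

/-- The Schouten tensor as a bilinear map. -/
def schoutenLin (G : Model n → Model n →L[ℝ] Model n →L[ℝ] ℝ) (y : Model n) :
    Model n →ₗ[ℝ] Model n →ₗ[ℝ] ℝ :=
  ((n : ℝ) - 2)⁻¹ • (ricciLin (christoffelCLM G) y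
    - (scalarCurv G y / (2 * ((n : ℝ) - 1))) • (ContinuousLinearMap.coeLM ℝ).comp (G y).toLinearMap)

lemma IsMetricOn.schouten_eq (hG : IsMetricOn G s) {y : Model n} (hy : y ∈ s) (v w : Model n) :
    schoutenCoord G y v w = schoutenLin G y v w := by
  simp [schoutenCoord, schoutenLin, hG.ricci_eq hy]
  ring

lemma IsMetricOn.raisedCoord_apply (hG : IsMetricOn G s) {y : Model n} (hy : y ∈ s) (j : Fin n)
    (v : Model n) : G y (raisedCoord G y j) v = v j := by
  rw [raisedCoord, hG.apply_inverse hy]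
  simp

/-- This pairing determines the raised vector without coordinates; it replaces the coordinate sum
from here on. -/
lemma IsMetricOn.metric_schoutenSharp (hG : IsMetricOn G s) {y : Model n} (hy : y ∈ s)
    (v w : Model n) : G y (schoutenSharpCoord G y v) w = schoutenCoord G y v w := by
  rw [schoutenSharpCoord, map_sum, sum_apply]
  simp only [map_smul, smul_apply, hG.raisedCoord_apply hy, smul_eq_mul,
    hG.schouten_eq hy]
  exact sum_single_apply_mul (schoutenLin G y v) w

lemma IsMetricOn.scalarCurv_eq (hG : IsMetricOn G s) {y : Model n} (hy : y ∈ s) :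
    scalarCurv G y = ∑ j, ricciLin (christoffelCLM G) y (raisedCoord G y j)
      (EuclideanSpace.single j 1) := by
  rw [scalarCurv]
  refine Finset.sum_congr rfl fun j _ => ?_
  simp only [hG.ricci_eq hy]
  have := sum_single_apply_mul ((ricciLin (christoffelCLM G) y).flip (EuclideanSpace.single j 1))
    (raisedCoord G y j)
  simpa [mul_comm] using this

end Basic

/-! ### Invariance of the connection and curvature under local isometries -/

section Naturality

variable {n : ℕ} {G₁ G₂ : Model n → Model n →L[ℝ] Model n →L[ℝ] ℝ} {s₁ s₂ : Set (Model n)}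
  {φ : Model n → Model n}

/-- `φ` is a smooth local isometry from `(s₁, G₁)` to `(s₂, G₂)`. -/
structure IsIsometryOn (G₁ : Model n → Model n →L[ℝ] Model n →L[ℝ] ℝ) (s₁ : Set (Model n))
    (G₂ : Model n → Model n →L[ℝ] Model n →L[ℝ] ℝ) (s₂ : Set (Model n))
    (φ : Model n → Model n) : Prop where
  left : IsMetricOn G₁ s₁
  right : IsMetricOn G₂ s₂
  smooth : ContDiffOn ℝ ∞ φ s₁
  mapsTo : MapsTo φ s₁ s₂
  pullback : ∀ y ∈ s₁, ∀ v w, G₁ y v w = G₂ (φ y) (fderiv ℝ φ y v) (fderiv ℝ φ y w)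

namespace IsIsometryOn

variable (h : IsIsometryOn G₁ s₁ G₂ s₂ φ)
include h

lemma contDiffAt {y : Model n} (hy : y ∈ s₁) : ContDiffAt ℝ ∞ φ y :=
  h.smooth.contDiffAt (h.left.isOpen.mem_nhds hy)

lemma hasFDerivAt {y : Model n} (hy : y ∈ s₁) : HasFDerivAt φ (fderiv ℝ φ y) y :=
  ((h.contDiffAt hy).differentiableAt (by simp)).hasFDerivAt

lemma contDiffAt_fderiv {y : Model n} (hy : y ∈ s₁) : ContDiffAt ℝ ∞ (fderiv ℝ φ) y :=
  (h.contDiffAt hy).fderiv_right (by simp)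

lemma hasFDerivAt_fderiv {y : Model n} (hy : y ∈ s₁) :
    HasFDerivAt (fderiv ℝ φ) (fderiv ℝ (fderiv ℝ φ) y) y :=
  ((h.contDiffAt_fderiv hy).differentiableAt (by simp)).hasFDerivAt

/-- A vector killed by the differential would have zero length for the pulled-back metric. In equal
dimensions the differential is then bijective, so every test vector at the image point is an image.
-/
lemma injective {y : Model n} (hy : y ∈ s₁) : Function.Injective (fderiv ℝ φ y).toLinearMap := by
  rw [← LinearMap.ker_eq_bot, LinearMap.ker_eq_bot']
  intro v hv
  by_contra hne
  have h1 := h.left.pos y hy v hne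
  have h2 : fderiv ℝ φ y v = 0 := hv
  rw [h.pullback y hy, h2] at h1
  simp at h1

/-- The differential of a local isometry as a linear equivalence. -/
def fderivEquiv {y : Model n} (hy : y ∈ s₁) : Model n ≃ₗ[ℝ] Model n :=
  LinearEquiv.ofInjectiveEndo _ (h.injective hy)

lemma fderivEquiv_apply {y : Model n} (hy : y ∈ s₁) (v : Model n) :
    h.fderivEquiv hy v = fderiv ℝ φ y v := rfl

lemma second_symm {y : Model n} (hy : y ∈ s₁) (u v : Model n) :
    fderiv ℝ (fderiv ℝ φ) y u v = fderiv ℝ (fderiv ℝ φ) y v u :=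
  (h.contDiffAt hy).isSymmSndFDerivAt (by simpa using WithTop.coe_le_coe.2 (le_top : (2 : ℕ∞) ≤ ⊤)) u v

lemma third_symm {y : Model n} (hy : y ∈ s₁) (u v : Model n) :
    fderiv ℝ (fderiv ℝ (fderiv ℝ φ)) y u v = fderiv ℝ (fderiv ℝ (fderiv ℝ φ)) y v u :=
  (h.contDiffAt_fderiv hy).isSymmSndFDerivAt (by simpa using WithTop.coe_le_coe.2 (le_top : (2 : ℕ∞) ≤ ⊤)) u v

lemma fderiv_metric {y : Model n} (hy : y ∈ s₁) (u v w : Model n) :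
    fderiv ℝ G₁ y u v w =
      fderiv ℝ G₂ (φ y) (fderiv ℝ φ y u) (fderiv ℝ φ y v) (fderiv ℝ φ y w)
      + G₂ (φ y) (fderiv ℝ (fderiv ℝ φ) y u v) (fderiv ℝ φ y w)
      + G₂ (φ y) (fderiv ℝ φ y v) (fderiv ℝ (fderiv ℝ φ) y u w) := by
  have h1 := ((h.left.hasFDerivAt hy).clm_apply (hasFDerivAt_const v y)).clm_apply
    (hasFDerivAt_const w y)
  have hφ := h.hasFDerivAt_fderiv hy
  have h2 := ((((h.right.hasFDerivAt (h.mapsTo hy)).comp y (h.hasFDerivAt hy)).clm_apply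
    (hφ.clm_apply (hasFDerivAt_const v y))).clm_apply (hφ.clm_apply (hasFDerivAt_const w y)))
  have h3 := h2.congr_of_eventuallyEq (f₁ := fun z => G₁ z v w) <| by
    filter_upwards [h.left.isOpen.mem_nhds hy] with z hz using h.pullback z hz v w
  have := congrArg (fun L => L u) (h1.unique h3)
  simp at this
  rw [this]
  ring

/-- In the Koszul formula the six second-derivative terms of `φ` cancel, up to two copies of the one
in `(v, w)`; these produce the inhomogeneous term. -/
lemma christoffel {y : Model n} (hy : y ∈ s₁) (v w : Model n) :
    fderiv ℝ φ y (christoffelCLM G₁ y v w) =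
      christoffelCLM G₂ (φ y) (fderiv ℝ φ y v) (fderiv ℝ φ y w)
      + fderiv ℝ (fderiv ℝ φ) y v w := by
  have hy2 := h.mapsTo hy
  refine h.right.ext_left hy2 fun z' => ?_
  obtain ⟨z, rfl⟩ := (h.fderivEquiv hy).surjective z'
  rw [h.fderivEquiv_apply, ← h.pullback y hy, h.left.koszul hy, map_add, add_apply,
    h.right.koszul hy2, h.fderiv_metric hy, h.fderiv_metric hy, h.fderiv_metric hy,
    h.second_symm hy w v, h.second_symm hy z v, h.second_symm hy z w,
    h.right.symm _ hy2 (fderiv ℝ φ y w), h.right.symm _ hy2 (fderiv ℝ φ y v)]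
  ring

/-- The derivative of the transformation law `christoffel` in the direction `u`. -/
lemma fderiv_christoffel {y : Model n} (hy : y ∈ s₁) (u v w : Model n) :
    fderiv ℝ (fderiv ℝ φ) y u (christoffelCLM G₁ y v w)
      + fderiv ℝ φ y (fderiv ℝ (christoffelCLM G₁) y u v w) =
    fderiv ℝ (christoffelCLM G₂) (φ y) (fderiv ℝ φ y u) (fderiv ℝ φ y v) (fderiv ℝ φ y w)
      + christoffelCLM G₂ (φ y) (fderiv ℝ (fderiv ℝ φ) y u v) (fderiv ℝ φ y w)
      + christoffelCLM G₂ (φ y) (fderiv ℝ φ y v) (fderiv ℝ (fderiv ℝ φ) y u w)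
      + fderiv ℝ (fderiv ℝ (fderiv ℝ φ)) y u v w := by
  have hφ := h.hasFDerivAt_fderiv hy
  have hφ3 : HasFDerivAt (fderiv ℝ (fderiv ℝ φ)) (fderiv ℝ (fderiv ℝ (fderiv ℝ φ)) y) y :=
    (((h.contDiffAt_fderiv hy).fderiv_right (m := ∞) (by simp)).differentiableAt
      (by simp)).hasFDerivAt
  have h1 := hφ.clm_apply (((h.left.hasFDerivAt_christoffelCLM hy).clm_apply
    (hasFDerivAt_const v y)).clm_apply (hasFDerivAt_const w y))
  have h2 := ((((h.right.hasFDerivAt_christoffelCLM (h.mapsTo hy)).comp y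
    (h.hasFDerivAt hy)).clm_apply (hφ.clm_apply (hasFDerivAt_const v y))).clm_apply
    (hφ.clm_apply (hasFDerivAt_const w y))).add
    ((hφ3.clm_apply (hasFDerivAt_const v y)).clm_apply (hasFDerivAt_const w y))
  have h3 := h2.congr_of_eventuallyEq
    (f₁ := fun z => fderiv ℝ φ z (christoffelCLM G₁ z v w)) <| by
    filter_upwards [h.left.isOpen.mem_nhds hy] with z hz using h.christoffel hz v w
  have := congrArg (fun L => L u) (h1.unique h3)
  simp at this
  rw [add_comm, this]
  abel

/-- Antisymmetrizing in `u` and `v` removes the third derivatives of `φ`, and the second derivatives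
cancel against those from the quadratic Christoffel terms. -/
lemma curv {y : Model n} (hy : y ∈ s₁) (u v w : Model n) :
    fderiv ℝ φ y (curv (christoffelCLM G₁) y u v w) =
      ConformalCurves.curv (christoffelCLM G₂) (φ y) (fderiv ℝ φ y u) (fderiv ℝ φ y v)
        (fderiv ℝ φ y w) := by
  have e1 := h.fderiv_christoffel hy u v w
  have e2 := h.fderiv_christoffel hy v u w
  rw [h.third_symm hy v u, h.second_symm hy v u] at e2
  have e1' := eq_sub_of_add_eq' e1
  have e2' := eq_sub_of_add_eq' e2
  simp only [ConformalCurves.curv, map_sub, map_add, e1', e2', h.christoffel hy]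
  abel

lemma ricci {y : Model n} (hy : y ∈ s₁) (v w : Model n) :
    ricciLin (christoffelCLM G₁) y v w =
      ricciLin (christoffelCLM G₂) (φ y) (fderiv ℝ φ y v) (fderiv ℝ φ y w) := by
  -- The coordinate sum is the trace of an endomorphism, and a trace is unchanged under conjugation
  -- by the differential.
  have key : ∀ (Γ : Model n → Model n →L[ℝ] Model n →L[ℝ] Model n) (z a b : Model n),
      ∃ L : Model n →ₗ[ℝ] Model n, (∀ u, L u = ConformalCurves.curv Γ z u a b) ∧
        ricciLin Γ z a b = LinearMap.trace ℝ _ L := by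
    intro Γ z a b
    refine ⟨{ toFun := fun u => ConformalCurves.curv Γ z u a b, map_add' := ?_, map_smul' := ?_ },
      fun u => rfl, ?_⟩
    · intro u u'
      simp only [ConformalCurves.curv, map_add, add_apply]
      abel
    · intro r u
      simp only [ConformalCurves.curv, map_smul, smul_apply, RingHom.id_apply]
      module
    · rw [trace_eq_sum_single]
      simp [ricciLin]
  obtain ⟨L₁, hL₁, e₁⟩ := key (christoffelCLM G₁) y v w
  obtain ⟨L₂, hL₂, e₂⟩ := key (christoffelCLM G₂) (φ y) (fderiv ℝ φ y v) (fderiv ℝ φ y w)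
  rw [e₁, e₂, ← LinearMap.trace_conj' L₁ (h.fderivEquiv hy)]
  congr 1
  ext1 u'
  obtain ⟨u, rfl⟩ := (h.fderivEquiv hy).surjective u'
  have hu : (h.fderivEquiv hy).symm (fderiv ℝ φ y u) = u :=
    (h.fderivEquiv hy).symm_apply_apply u
  simp [LinearEquiv.conj_apply, hL₁, hL₂, hu, h.fderivEquiv_apply, h.curv hy]

lemma scalarCurv {y : Model n} (hy : y ∈ s₁) :
    scalarCurv G₁ y = ConformalCurves.scalarCurv G₂ (φ y) := by
  -- Scalar curvature is the trace of the Ricci endomorphism. The arguments `v u` occur in this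
  -- order so that symmetry of the Ricci tensor is not needed.
  have key : ∀ (G : Model n → Model n →L[ℝ] Model n →L[ℝ] ℝ) (s : Set (Model n)),
      IsMetricOn G s → ∀ z ∈ s, ∃ L : Model n →ₗ[ℝ] Model n,
        (∀ u v, G z (L u) v = ricciLin (christoffelCLM G) z v u) ∧
        ConformalCurves.scalarCurv G z = LinearMap.trace ℝ _ L := by
    intro G s hG z hz
    have hL : ∀ u v, G z ((G z).inverse (LinearMap.toContinuousLinearMap
        ((ricciLin (christoffelCLM G) z).flip u))) v = ricciLin (christoffelCLM G) z v u := by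
      intro u v
      rw [hG.apply_inverse hz]
      simp
    refine ⟨(G z).inverse.toLinearMap ∘ₗ (LinearMap.toContinuousLinearMap.toLinearMap ∘ₗ
      (ricciLin (christoffelCLM G) z).flip), hL, ?_⟩
    rw [trace_eq_sum_single, hG.scalarCurv_eq hz]
    refine Finset.sum_congr rfl fun j _ => ?_
    rw [← hG.raisedCoord_apply hz, hG.symm z hz]
    exact (hL _ _).symm
  obtain ⟨L₁, hL₁, e₁⟩ := key G₁ s₁ h.left y hy
  obtain ⟨L₂, hL₂, e₂⟩ := key G₂ s₂ h.right (φ y) (h.mapsTo hy)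
  rw [e₁, e₂, ← LinearMap.trace_conj' L₁ (h.fderivEquiv hy)]
  congr 1
  ext1 u'
  obtain ⟨u, rfl⟩ := (h.fderivEquiv hy).surjective u'
  refine h.right.ext_left (h.mapsTo hy) fun z' => ?_
  obtain ⟨z, rfl⟩ := (h.fderivEquiv hy).surjective z'
  have hu : (h.fderivEquiv hy).symm (fderiv ℝ φ y u) = u :=
    (h.fderivEquiv hy).symm_apply_apply u
  simp [LinearEquiv.conj_apply, hL₁, hL₂, hu, h.fderivEquiv_apply, ← h.pullback y hy, ← h.ricci hy]

lemma schouten {y : Model n} (hy : y ∈ s₁) (v w : Model n) :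
    schoutenCoord G₁ y v w = schoutenCoord G₂ (φ y) (fderiv ℝ φ y v) (fderiv ℝ φ y w) := by
  rw [schoutenCoord, schoutenCoord, h.left.ricci_eq hy, h.right.ricci_eq (h.mapsTo hy),
    h.ricci hy, h.scalarCurv hy, h.pullback y hy]

end IsIsometryOn

end Naturality

/-! ### Conformal change of the connection and of the Schouten tensor in coordinates -/

/-- On `s` the metric `H` is `ψ² G`, and `Y` is the `G`-gradient of `log ψ`. -/
structure IsRescalingOn {n : ℕ} (H G : Model n → Model n →L[ℝ] Model n →L[ℝ] ℝ)
    (ψ : Model n → ℝ) (Y : Model n → Model n) (s : Set (Model n)) : Prop where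
  left : IsMetricOn H s
  right : IsMetricOn G s
  smooth : ContDiffOn ℝ ∞ ψ s
  smooth_grad : ContDiffOn ℝ ∞ Y s
  pos : ∀ y ∈ s, 0 < ψ y
  eq : ∀ y ∈ s, ∀ v w, H y v w = ψ y ^ 2 * G y v w
  grad : ∀ y ∈ s, ∀ v, ψ y * G y (Y y) v = fderiv ℝ ψ y v

namespace IsRescalingOn

variable {n : ℕ} {H G : Model n → Model n →L[ℝ] Model n →L[ℝ] ℝ} {ψ : Model n → ℝ}
  {Y : Model n → Model n} {s : Set (Model n)} (h : IsRescalingOn H G ψ Y s)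
include h

lemma contDiffAt {y : Model n} (hy : y ∈ s) : ContDiffAt ℝ ∞ ψ y :=
  h.smooth.contDiffAt (h.left.isOpen.mem_nhds hy)

lemma hasFDerivAt {y : Model n} (hy : y ∈ s) : HasFDerivAt ψ (fderiv ℝ ψ y) y :=
  ((h.contDiffAt hy).differentiableAt (by simp)).hasFDerivAt

lemma hasFDerivAt_grad {y : Model n} (hy : y ∈ s) : HasFDerivAt Y (fderiv ℝ Y y) y :=
  ((h.smooth_grad.contDiffAt (h.left.isOpen.mem_nhds hy)).differentiableAt (by simp)).hasFDerivAt

lemma fderiv_metric {y : Model n} (hy : y ∈ s) (u v w : Model n) :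
    fderiv ℝ H y u v w = ψ y ^ 2 * (fderiv ℝ G y u v w + 2 * G y (Y y) u * G y v w) := by
  have h1 := ((h.left.hasFDerivAt hy).clm_apply (hasFDerivAt_const v y)).clm_apply
    (hasFDerivAt_const w y)
  have h2 := ((h.hasFDerivAt hy).pow 2).mul (((h.right.hasFDerivAt hy).clm_apply
    (hasFDerivAt_const v y)).clm_apply (hasFDerivAt_const w y))
  have h3 := h2.congr_of_eventuallyEq (f₁ := fun z => H z v w) <| by
    filter_upwards [h.left.isOpen.mem_nhds hy] with z hz using h.eq z hz v w
  have := congrArg (fun L => L u) (h1.unique h3)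
  simp [← h.grad y hy] at this
  rw [this]
  ring

/-- Each derivative of `ψ²` in the Koszul formula is `2ψ²` times a pairing with `Y`, so the common
factor `ψ²` drops out. -/
lemma christoffel {y : Model n} (hy : y ∈ s) (v w : Model n) :
    christoffelCLM H y v w = christoffelCLM G y v w + G y (Y y) v • w + G y (Y y) w • v
      - G y v w • Y y := by
  refine h.left.ext_left hy fun z => ?_
  rw [h.left.koszul hy, h.eq y hy, h.fderiv_metric hy, h.fderiv_metric hy, h.fderiv_metric hy]
  simp only [map_add, map_sub, map_smul, add_apply, sub_apply, smul_apply, smul_eq_mul,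
    h.right.koszul hy]
  ring

/-- The covariant derivative of the gradient. -/
def hess (_ : IsRescalingOn H G ψ Y s) (y : Model n) : Model n →L[ℝ] Model n :=
  fderiv ℝ Y y + (christoffelCLM G y).flip (Y y)

lemma hess_apply (y u : Model n) :
    h.hess y u = fderiv ℝ Y y u + christoffelCLM G y u (Y y) := by
  simp [hess]

lemma fderiv_eq (y u : Model n) :
    fderiv ℝ Y y u = h.hess y u - christoffelCLM G y u (Y y) := by
  rw [h.hess_apply]; abel

/-- A gradient field has a symmetric covariant derivative, because second derivatives of `ψ` commute
and the connection has no torsion. -/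
lemma hess_symm {y : Model n} (hy : y ∈ s) (u v : Model n) :
    G y (h.hess y u) v = G y (h.hess y v) u := by
  -- This is the derivative of the relation `grad` in the direction `a`; every term on the right
  -- turns out to be symmetric.
  have key : ∀ a b, ψ y * G y (h.hess y a) b = fderiv ℝ (fderiv ℝ ψ) y a b
      - fderiv ℝ ψ y a * G y (Y y) b - ψ y * G y (Y y) (christoffelCLM G y a b) := by
    intro a b
    have h1 := (h.hasFDerivAt hy).mul (((h.right.hasFDerivAt hy).clm_apply
      (h.hasFDerivAt_grad hy)).clm_apply (hasFDerivAt_const b y))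
    have h2 : HasFDerivAt (fderiv ℝ ψ) (fderiv ℝ (fderiv ℝ ψ) y) y :=
      (((h.contDiffAt hy).fderiv_right (m := ∞) (by simp)).differentiableAt (by simp)).hasFDerivAt
    have h3 := (h2.clm_apply (hasFDerivAt_const b y)).congr_of_eventuallyEq
        (f₁ := fun z => ψ z * G z (Y z) b) <| by
      filter_upwards [h.left.isOpen.mem_nhds hy] with z hz using h.grad z hz b
    have := congrArg (fun L => L a) (h1.unique h3)
    simp at this
    rw [h.right.compatible hy, h.fderiv_eq, map_sub, sub_apply] at this
    linarith
  have e1 := key u v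
  have e2 := key v u
  have e3 : fderiv ℝ (fderiv ℝ ψ) y u v = fderiv ℝ (fderiv ℝ ψ) y v u :=
    (h.contDiffAt hy).isSymmSndFDerivAt (by simpa using WithTop.coe_le_coe.2 (le_top : (2 : ℕ∞) ≤ ⊤)) u v
  rw [← h.grad y hy, h.right.christoffel_symm hy] at e1
  rw [← h.grad y hy] at e2
  have := (h.pos y hy).ne'
  apply mul_left_cancel₀ this
  rw [e1, e2, e3]
  ring

lemma fderiv_christoffel {y : Model n} (hy : y ∈ s) (u v w : Model n) :
    fderiv ℝ (christoffelCLM H) y u v w = fderiv ℝ (christoffelCLM G) y u v w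
      + (G y (h.hess y u) v + G y (Y y) (christoffelCLM G y u v)) • w
      + (G y (h.hess y u) w + G y (Y y) (christoffelCLM G y u w)) • v
      - (G y (christoffelCLM G y u v) w + G y v (christoffelCLM G y u w)) • Y y
      - G y v w • (h.hess y u - christoffelCLM G y u (Y y)) := by
  have hG := h.right.hasFDerivAt hy
  have hY := h.hasFDerivAt_grad hy
  have h1 := ((h.left.hasFDerivAt_christoffelCLM hy).clm_apply (hasFDerivAt_const v y)).clm_apply
    (hasFDerivAt_const w y)
  have hv := (hG.clm_apply hY).clm_apply (hasFDerivAt_const v y)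
  have hw := (hG.clm_apply hY).clm_apply (hasFDerivAt_const w y)
  have hvw := (hG.clm_apply (hasFDerivAt_const v y)).clm_apply (hasFDerivAt_const w y)
  have h2 := ((((h.right.hasFDerivAt_christoffelCLM hy).clm_apply
    (hasFDerivAt_const v y)).clm_apply (hasFDerivAt_const w y)).add
    (hv.smul (hasFDerivAt_const w y))).add (hw.smul (hasFDerivAt_const v y)) |>.sub
    (hvw.smul hY)
  have h3 := h2.congr_of_eventuallyEq (f₁ := fun z => christoffelCLM H z v w) <| by
    filter_upwards [h.left.isOpen.mem_nhds hy] with z hz using h.christoffel hz v w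
  have := congrArg (fun L => L u) (h1.unique h3)
  simp [h.right.compatible hy, h.fderiv_eq] at this
  rw [this]
  module

/-- All bare Christoffel terms cancel by torsion-freeness. What remains is tensorial: a part linear
in the Hessian and a part quadratic in `Y`. -/
lemma curv {y : Model n} (hy : y ∈ s) (u v w : Model n) :
    curv (christoffelCLM H) y u v w = curv (christoffelCLM G) y u v w
      + (G y (h.hess y u) w • v - G y (h.hess y v) w • u - G y v w • h.hess y u
        + G y u w • h.hess y v)
      + ((G y (Y y) v * G y (Y y) w) • u - (G y (Y y) u * G y (Y y) w) • v
        - (G y (Y y) v * G y u w) • Y y + (G y (Y y) u * G y v w) • Y y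
        - (G y (Y y) (Y y) * G y v w) • u + (G y (Y y) (Y y) * G y u w) • v) := by
  simp only [ConformalCurves.curv, h.fderiv_christoffel hy, h.christoffel hy, map_add, map_sub,
    map_smul, smul_eq_mul]
  rw [h.hess_symm hy v u, h.right.christoffel_symm hy v u, h.right.symm y hy u (Y y),
    h.right.symm y hy v (Y y), h.right.symm y hy v u,
    h.right.symm y hy u (christoffelCLM G y v w), h.right.symm y hy v (christoffelCLM G y u w)]
  module

/-- The divergence of the gradient. -/
def laplacian (h : IsRescalingOn H G ψ Y s) (y : Model n) : ℝ :=
  ∑ i, h.hess y (EuclideanSpace.single i 1) i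

lemma ricci {y : Model n} (hy : y ∈ s) (v w : Model n) :
    ricciLin (christoffelCLM H) y v w = ricciLin (christoffelCLM G) y v w
      - ((n : ℝ) - 2) * G y (h.hess y v) w - h.laplacian y * G y v w
      + ((n : ℝ) - 2) * (G y (Y y) v * G y (Y y) w - G y (Y y) (Y y) * G y v w) := by
  -- `s1`, `s2`, `s3` evaluate the contractions in the trace of `curv` over its first argument;
  -- summing the constant terms over `i` produces the dimension `n`.
  have s1 : ∑ i, G y (h.hess y (EuclideanSpace.single i 1)) w * v i = G y (h.hess y v) w :=
    sum_single_apply_mul (((G y).flip w).comp (h.hess y)).toLinearMap v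
  have s2 : ∀ x : Model n, ∑ i, G y (EuclideanSpace.single i 1) w * x i = G y x w := fun x =>
    sum_single_apply_mul ((G y).flip w).toLinearMap x
  have s3 : ∀ x : Model n, ∑ i, G y (Y y) (EuclideanSpace.single i 1) * x i = G y (Y y) x := fun x =>
    sum_single_apply_mul (G y (Y y)).toLinearMap x
  have e : ricciLin (christoffelCLM H) y v w - ricciLin (christoffelCLM G) y v w =
      ∑ i, (G y (h.hess y (EuclideanSpace.single i 1)) w * v i - G y (h.hess y v) w
        - G y v w * h.hess y (EuclideanSpace.single i 1) i
        + G y (EuclideanSpace.single i 1) w * h.hess y v i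
        + (G y (Y y) v * G y (Y y) w)
        - G y (Y y) w * (G y (Y y) (EuclideanSpace.single i 1) * v i)
        - G y (Y y) v * (G y (EuclideanSpace.single i 1) w * Y y i)
        + G y v w * (G y (Y y) (EuclideanSpace.single i 1) * Y y i)
        - G y (Y y) (Y y) * G y v w
        + G y (Y y) (Y y) * (G y (EuclideanSpace.single i 1) w * v i)) := by
    simp only [ricciLin, LinearMap.mk₂_apply, ← Finset.sum_sub_distrib]
    refine Finset.sum_congr rfl fun i _ => ?_
    rw [h.curv hy]
    simp
    ring
  rw [eq_add_of_sub_eq' e]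
  simp only [Finset.sum_add_distrib, Finset.sum_sub_distrib, ← Finset.mul_sum, s1, s2, s3,
    laplacian, Finset.sum_const, Finset.card_univ, Fintype.card_fin, nsmul_eq_mul]
  ring

lemma raisedCoord {y : Model n} (hy : y ∈ s) (j : Fin n) :
    raisedCoord H y j = (ψ y ^ 2)⁻¹ • ConformalCurves.raisedCoord G y j := by
  refine h.left.ext_left hy fun z => ?_
  have := (h.pos y hy).ne'
  rw [h.left.raisedCoord_apply hy, map_smul, smul_apply, h.eq y hy,
    h.right.raisedCoord_apply hy, smul_eq_mul]
  field_simp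

lemma scalarCurv {y : Model n} (hy : y ∈ s) :
    scalarCurv H y = (ψ y ^ 2)⁻¹ * (ConformalCurves.scalarCurv G y
      - 2 * ((n : ℝ) - 1) * h.laplacian y
      - ((n : ℝ) - 1) * ((n : ℝ) - 2) * G y (Y y) (Y y)) := by
  have s1 : ∑ j, G y (h.hess y (ConformalCurves.raisedCoord G y j)) (EuclideanSpace.single j 1) =
      h.laplacian y := Finset.sum_congr rfl fun j _ => by
    rw [h.hess_symm hy, h.right.symm y hy, h.right.raisedCoord_apply hy]
  have s2 : ∑ j, G y (Y y) (ConformalCurves.raisedCoord G y j) *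
      G y (Y y) (EuclideanSpace.single j 1) = G y (Y y) (Y y) := by
    refine Eq.trans ?_ (sum_single_apply_mul (G y (Y y)).toLinearMap (Y y))
    refine Finset.sum_congr rfl fun j _ => ?_
    rw [h.right.symm y hy (Y y) (ConformalCurves.raisedCoord G y j),
      h.right.raisedCoord_apply hy, mul_comm]
    rfl
  rw [h.left.scalarCurv_eq hy, h.right.scalarCurv_eq hy]
  simp only [h.raisedCoord hy, map_smul, LinearMap.smul_apply, smul_eq_mul, ← Finset.mul_sum]
  congr 1
  simp only [h.ricci hy, h.right.raisedCoord_apply hy, Finset.sum_add_distrib,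
    Finset.sum_sub_distrib, ← Finset.mul_sum, s1, s2]
  simp
  ring

/-- The normalization of the Schouten tensor is chosen so that the Laplacians in the Ricci and
scalar curvatures cancel. The factor `n - 2` then divides out, which needs `n ≥ 3`. -/
lemma schouten (hn : 3 ≤ n) {y : Model n} (hy : y ∈ s) (v w : Model n) :
    schoutenCoord H y v w = schoutenCoord G y v w - G y (h.hess y v) w
      + G y (Y y) v * G y (Y y) w - 1 / 2 * G y (Y y) (Y y) * G y v w := by
  have h3 : (3 : ℝ) ≤ n := by exact_mod_cast hn
  have n1 : (n : ℝ) - 1 ≠ 0 := by linarith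
  have n2 : (n : ℝ) - 2 ≠ 0 := by linarith
  have := (h.pos y hy).ne'
  rw [schoutenCoord, schoutenCoord, h.left.ricci_eq hy, h.right.ricci_eq hy, h.ricci hy,
    h.scalarCurv hy, h.eq y hy]
  field_simp
  ring

end IsRescalingOn

/-! ### From coordinates to the manifold: charts and their transitions -/

section Charts

set_option linter.unusedSectionVars false

variable {n : ℕ} {M : Type*} [TopologicalSpace M] [ChartedSpace (Model n) M]
  [IsManifold (𝓡 n) ∞ M]

instance : IsManifold (𝓡 n) 1 M := IsManifold.of_le (n := ∞) (by simp)

/-- The differential at `x` of the chart centred at `p`. -/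
def chartD (p x : M) : TangentSpace (𝓡 n) x →L[ℝ] Model n :=
  mfderiv (𝓡 n) 𝓘(ℝ, Model n) (extChartAt (𝓡 n) p) x

/-- The differential at `y` of the inverse of the chart centred at `p`. -/
def chartDSymm (p : M) (y : Model n) :
    Model n →L[ℝ] TangentSpace (𝓡 n) ((extChartAt (𝓡 n) p).symm y) :=
  mfderiv 𝓘(ℝ, Model n) (𝓡 n) (extChartAt (𝓡 n) p).symm y

lemma chartD_chartDSymm {p : M} {y : Model n} (hy : y ∈ (extChartAt (𝓡 n) p).target)
    (v : Model n) : chartD p _ (chartDSymm p y v) = v := by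
  have := mfderiv_extChartAt_comp_mfderivWithin_extChartAt_symm hy
  rw [ModelWithCorners.range_eq_univ, mfderivWithin_univ] at this
  exact congrArg (fun L => L v) this

lemma chartDSymm_chartD {p : M} {y : Model n} (hy : y ∈ (extChartAt (𝓡 n) p).target)
    (v : TangentSpace (𝓡 n) ((extChartAt (𝓡 n) p).symm y)) :
    chartDSymm p y (chartD p _ v) = v := by
  have := mfderivWithin_extChartAt_symm_comp_mfderiv_extChartAt hy
  rw [ModelWithCorners.range_eq_univ, mfderivWithin_univ] at this
  exact congrArg (fun L => L v) this

lemma chartD_self (x : M) (v : TangentSpace (𝓡 n) x) : chartD x x v = v := by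
  have := mfderiv_extChartAt_self (I := 𝓡 n) (x := x)
  exact congrArg (fun L => L v) this

/-- Smoothness in the tangent bundle is tested in its trivializations; this turns the test into one
on chart coordinates. -/
lemma chartD_eq_trivialization {p x : M} (hx : x ∈ (extChartAt (𝓡 n) p).source)
    (v : TangentSpace (𝓡 n) x) :
    chartD p x v = (trivializationAt (Model n) (TangentSpace (𝓡 n)) p ⟨x, v⟩).2 := by
  rw [extChartAt_source] at hx
  have h := TangentBundle.continuousLinearMapAt_trivializationAt (I := 𝓡 n) hx
  have := congrArg (fun L => L v) h
  refine Eq.trans this.symm ?_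
  rw [Trivialization.continuousLinearMapAt_apply, Trivialization.linearMapAt_apply, if_pos]
  simpa using hx

lemma exists_mem_target {p x : M} (hx : x ∈ (extChartAt (𝓡 n) p).source) :
    ∃ y ∈ (extChartAt (𝓡 n) p).target, (extChartAt (𝓡 n) p).symm y = x :=
  ⟨_, (extChartAt (𝓡 n) p).map_source hx, (extChartAt (𝓡 n) p).left_inv hx⟩

lemma chartD_injective {p x : M} (hx : x ∈ (extChartAt (𝓡 n) p).source) :
    Function.Injective (chartD (n := n) p x) := by
  obtain ⟨y, hy, rfl⟩ := exists_mem_target hx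
  exact Function.LeftInverse.injective (chartDSymm_chartD hy)

lemma coordMetric_apply (g : Metric n M) (p : M) (y v w : Model n) :
    coordMetric g p y v w =
      g.inner ((extChartAt (𝓡 n) p).symm y) (chartDSymm p y v) (chartDSymm p y w) := rfl

lemma coordMetric_chartD (g : Metric n M) {p x : M} (hx : x ∈ (extChartAt (𝓡 n) p).source)
    (v w : TangentSpace (𝓡 n) x) :
    coordMetric g p (extChartAt (𝓡 n) p x) (chartD p x v) (chartD p x w) = g.inner x v w := by
  obtain ⟨y, hy, rfl⟩ := exists_mem_target hx
  rw [(extChartAt (𝓡 n) p).right_inv hy, coordMetric_apply, chartDSymm_chartD hy,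
    chartDSymm_chartD hy]

/-- A coordinate field has constant coordinates in its own trivialization. -/
lemma contMDiffOn_chartDSymm (p : M) (v : Model n) :
    ContMDiffOn 𝓘(ℝ, Model n) (𝓡 n).tangent ∞
      (fun y => (⟨(extChartAt (𝓡 n) p).symm y, chartDSymm p y v⟩ : TangentBundle (𝓡 n) M))
      (extChartAt (𝓡 n) p).target := by
  intro y hy
  have ho := isOpen_extChartAt_target (I := 𝓡 n) p
  refine ContMDiffAt.contMDiffWithinAt ?_
  have hs : ((extChartAt (𝓡 n) p).symm y) ∈ (chartAt (Model n) p).source := by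
    rw [← extChartAt_source (𝓡 n)]; exact (extChartAt (𝓡 n) p).map_target hy
  rw [Trivialization.contMDiffAt_iff (e := trivializationAt (Model n) (TangentSpace (𝓡 n)) p)
    (by simpa [Trivialization.mem_source] using hs)]
  refine ⟨(contMDiffOn_extChartAt_symm p).contMDiffAt (ho.mem_nhds hy), ?_⟩
  refine (contMDiffAt_const (c := v)).congr_of_eventuallyEq ?_
  filter_upwards [ho.mem_nhds hy] with z hz
  rw [← chartD_eq_trivialization ((extChartAt (𝓡 n) p).map_target hz), chartD_chartDSymm hz]

lemma contDiffAt_metric {E' : Type*} [NormedAddCommGroup E'] [NormedSpace ℝ E']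
    (g : Metric n M) {b : E' → M} {V W : ∀ t, TangentSpace (𝓡 n) (b t)} {t : E'}
    (hV : ContMDiffAt 𝓘(ℝ, E') (𝓡 n).tangent ∞
      (fun t => (⟨b t, V t⟩ : TangentBundle (𝓡 n) M)) t)
    (hW : ContMDiffAt 𝓘(ℝ, E') (𝓡 n).tangent ∞
      (fun t => (⟨b t, W t⟩ : TangentBundle (𝓡 n) M)) t) :
    ContDiffAt ℝ ∞ (fun t => g.inner (b t) (V t) (W t)) t := by
  have hb := (contMDiffAt_totalSpace.1 hV).1
  have : ContMDiffAt 𝓘(ℝ, E') ((𝓡 n).prod 𝓘(ℝ, ℝ)) ∞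
      (fun m ↦ TotalSpace.mk' ℝ (E := Bundle.Trivial M ℝ) (b m) (g.inner (b m) (V m) (W m))) t := by
    apply ContMDiffAt.clm_bundle_apply₂ (F₁ := Model n) (F₂ := Model n)
    · exact ContMDiffAt.comp t g.contMDiff.contMDiffAt hb
    · exact hV
    · exact hW
  simp only [contMDiffAt_totalSpace] at this
  exact this.2.contDiffAt

lemma isMetricOn_coordMetric (g : Metric n M) (p : M) :
    IsMetricOn (coordMetric g p) (extChartAt (𝓡 n) p).target where
  isOpen := isOpen_extChartAt_target p
  smooth := by
    rw [contDiffOn_clm_apply]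
    intro v
    rw [contDiffOn_clm_apply]
    intro w y hy
    have ho := (isOpen_extChartAt_target (I := 𝓡 n) p).mem_nhds hy
    have h : ContDiffAt ℝ ∞ (fun z => coordMetric g p z v w) y :=
      contDiffAt_metric g (b := (extChartAt (𝓡 n) p).symm) (V := fun z => chartDSymm p z v)
        (W := fun z => chartDSymm p z w) ((contMDiffOn_chartDSymm p v).contMDiffAt ho)
        ((contMDiffOn_chartDSymm p w).contMDiffAt ho)
    exact h.contDiffWithinAt
  symm y hy v w := g.symm _ _ _
  pos y hy v hv := by
    have hne : chartDSymm p y v ≠ 0 := fun h => hv <| by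
      rw [← chartD_chartDSymm hy v, h, map_zero]
    rw [coordMetric_apply]
    exact g.pos _ (chartDSymm p y v) hne

/-- The change from the chart at `p` to the chart at `p'`. -/
def transition (n : ℕ) {M : Type*} [TopologicalSpace M] [ChartedSpace (Model n) M] (p p' : M)
    (y : Model n) : Model n :=
  extChartAt (𝓡 n) p' ((extChartAt (𝓡 n) p).symm y)

/-- The domain of the change from the chart at `p` to the chart at `p'`. -/
def transitionDomain (n : ℕ) {M : Type*} [TopologicalSpace M] [ChartedSpace (Model n) M]
    (p p' : M) : Set (Model n) :=
  (extChartAt (𝓡 n) p).target ∩ (extChartAt (𝓡 n) p).symm ⁻¹' (extChartAt (𝓡 n) p').source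

lemma isOpen_transitionDomain (p p' : M) : IsOpen (transitionDomain n p p') :=
  (continuousOn_extChartAt_symm p).isOpen_inter_preimage (isOpen_extChartAt_target p)
    (isOpen_extChartAt_source p')

lemma contDiffOn_transition (p p' : M) :
    ContDiffOn ℝ ∞ (transition n p p') (transitionDomain n p p') := by
  rw [← contMDiffOn_iff_contDiffOn]
  have h1 : ContMDiffOn (𝓡 n) 𝓘(ℝ, Model n) ∞ (extChartAt (𝓡 n) p')
      (extChartAt (𝓡 n) p').source := by
    rw [extChartAt_source]; exact contMDiffOn_extChartAt
  exact h1.comp ((contMDiffOn_extChartAt_symm p).mono inter_subset_left) fun y hy => hy.2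

lemma fderiv_transition {p p' : M} {y : Model n} (hy : y ∈ transitionDomain n p p')
    (v : Model n) : fderiv ℝ (transition n p p') y v = chartD p' _ (chartDSymm p y v) := by
  have h1 : MDifferentiableAt 𝓘(ℝ, Model n) (𝓡 n) (extChartAt (𝓡 n) p).symm y := by
    have := mdifferentiableWithinAt_extChartAt_symm (I := 𝓡 n) hy.1
    rwa [ModelWithCorners.range_eq_univ, mdifferentiableWithinAt_univ] at this
  have h2 : MDifferentiableAt (𝓡 n) 𝓘(ℝ, Model n) (extChartAt (𝓡 n) p')
      ((extChartAt (𝓡 n) p).symm y) :=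
    mdifferentiableAt_extChartAt (by rw [← extChartAt_source (𝓡 n)]; exact hy.2)
  have h3 := mfderiv_comp y h2 h1
  rw [mfderiv_eq_fderiv] at h3
  exact congrArg (fun L => L v) h3

lemma mem_transitionDomain {p p' x : M} (hx : x ∈ (extChartAt (𝓡 n) p).source)
    (hx' : x ∈ (extChartAt (𝓡 n) p').source) :
    extChartAt (𝓡 n) p x ∈ transitionDomain n p p' :=
  ⟨(extChartAt (𝓡 n) p).map_source hx, by
    rw [mem_preimage, (extChartAt (𝓡 n) p).left_inv hx]; exact hx'⟩

lemma transition_extChartAt {p p' x : M} (hx : x ∈ (extChartAt (𝓡 n) p).source) :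
    transition n p p' (extChartAt (𝓡 n) p x) = extChartAt (𝓡 n) p' x := by
  rw [transition, (extChartAt (𝓡 n) p).left_inv hx]

lemma fderiv_transition_chartD {p p' x : M} (hx : x ∈ (extChartAt (𝓡 n) p).source)
    (hx' : x ∈ (extChartAt (𝓡 n) p').source) (v : TangentSpace (𝓡 n) x) :
    fderiv ℝ (transition n p p') (extChartAt (𝓡 n) p x) (chartD p x v) = chartD p' x v := by
  have hd := mem_transitionDomain hx hx'
  obtain ⟨y, hy, rfl⟩ := exists_mem_target hx
  rw [(extChartAt (𝓡 n) p).right_inv hy] at hd ⊢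
  rw [fderiv_transition hd, chartDSymm_chartD hy]

/-- Both coordinate metrics are pull-backs of `g`, so the naturality results apply to every change
of chart. -/
lemma isIsometryOn_transition (g : Metric n M) (p p' : M) :
    IsIsometryOn (coordMetric g p) (transitionDomain n p p') (coordMetric g p')
      (extChartAt (𝓡 n) p').target (transition n p p') where
  left :=
    { isOpen := isOpen_transitionDomain p p'
      smooth := (isMetricOn_coordMetric g p).smooth.mono inter_subset_left
      symm := fun y hy => (isMetricOn_coordMetric g p).symm y hy.1
      pos := fun y hy => (isMetricOn_coordMetric g p).pos y hy.1 }
  right := isMetricOn_coordMetric g p'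
  smooth := contDiffOn_transition p p'
  mapsTo y hy := (extChartAt (𝓡 n) p').map_source hy.2
  pullback y hy v w := by
    rw [fderiv_transition hy, fderiv_transition hy, transition, coordMetric_chartD g hy.2]
    rfl

/-- The defining chart of `schouten g x` moves with `x`. Smoothness and differentiation along a
curve require one fixed chart, which naturality permits. -/
lemma schouten_eq_chart (g : Metric n M) {p x : M} (hx : x ∈ (extChartAt (𝓡 n) p).source)
    (v w : TangentSpace (𝓡 n) x) :
    schouten g x v w = schoutenCoord (coordMetric g p) (extChartAt (𝓡 n) p x) (chartD p x v)
      (chartD p x w) := by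
  have h0 := mem_extChartAt_source (I := 𝓡 n) x
  have h := (isIsometryOn_transition g x p).schouten (mem_transitionDomain h0 hx)
    (chartD x x v) (chartD x x w)
  rw [fderiv_transition_chartD h0 hx, fderiv_transition_chartD h0 hx, transition_extChartAt h0] at h
  rw [← h, chartD_self, chartD_self]
  rfl

end Charts

/-! ### Covariant calculus along a smooth curve -/

lemma contDiffAt_deriv {F : Type*} [NormedAddCommGroup F] [NormedSpace ℝ F] {f : ℝ → F} {t : ℝ}
    (hf : ContDiffAt ℝ ∞ f t) : ContDiffAt ℝ ∞ (deriv f) t :=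
  (hf.fderiv_right (m := ∞) (by simp)).clm_apply contDiffAt_const

section Curves

set_option linter.unusedSectionVars false

variable {n : ℕ} {M : Type*} [TopologicalSpace M] [ChartedSpace (Model n) M]
  [IsManifold (𝓡 n) ∞ M]

variable (n) in
/-- `γ` is a smooth curve on the open set `J` of parameters. -/
structure IsSmoothCurve (γ : ℝ → M) (J : Set ℝ) : Prop where
  isOpen : IsOpen J
  smooth : ContMDiffOn 𝓘(ℝ, ℝ) (𝓡 n) ∞ γ J

/-- `V` is a smooth vector field along `γ`. -/
def IsSmoothAlong (γ : ℝ → M) (J : Set ℝ) (V : ∀ t, TangentSpace (𝓡 n) (γ t)) : Prop :=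
  ContMDiffOn 𝓘(ℝ, ℝ) (𝓡 n).tangent ∞ (fun t => (⟨γ t, V t⟩ : TangentBundle (𝓡 n) M)) J

/-- The coordinates, in the chart at `p`, of a vector field along a curve. -/
def coordField (p : M) (γ : ℝ → M) (V : ∀ t, TangentSpace (𝓡 n) (γ t)) (s : ℝ) : Model n :=
  chartD p (γ s) (V s)

variable {γ : ℝ → M} {J : Set ℝ} {V W : ∀ t, TangentSpace (𝓡 n) (γ t)} {t : ℝ} {p : M}

namespace IsSmoothCurve

lemma contMDiffAt (hc : IsSmoothCurve n γ J) (ht : t ∈ J) : ContMDiffAt 𝓘(ℝ, ℝ) (𝓡 n) ∞ γ t :=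
  hc.smooth.contMDiffAt (hc.isOpen.mem_nhds ht)

lemma eventually_mem_source (hc : IsSmoothCurve n γ J) (ht : t ∈ J)
    (hp : γ t ∈ (extChartAt (𝓡 n) p).source) :
    ∀ᶠ s in nhds t, s ∈ J ∧ γ s ∈ (extChartAt (𝓡 n) p).source :=
  Filter.Eventually.and (hc.isOpen.mem_nhds ht)
    ((hc.contMDiffAt ht).continuousAt.eventually ((isOpen_extChartAt_source p).mem_nhds hp))

lemma contDiffAt_coord (hc : IsSmoothCurve n γ J) (ht : t ∈ J)
    (hp : γ t ∈ (extChartAt (𝓡 n) p).source) :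
    ContDiffAt ℝ ∞ (fun s => extChartAt (𝓡 n) p (γ s)) t := by
  rw [extChartAt_source] at hp
  have h1 : ContMDiffAt (𝓡 n) 𝓘(ℝ, Model n) ∞ (extChartAt (𝓡 n) p) (γ t) :=
    contMDiffOn_extChartAt.contMDiffAt ((chartAt (Model n) p).open_source.mem_nhds hp)
  exact (h1.comp t (hc.contMDiffAt ht)).contDiffAt

lemma hasDerivAt_coord (hc : IsSmoothCurve n γ J) (ht : t ∈ J)
    (hp : γ t ∈ (extChartAt (𝓡 n) p).source) :
    HasDerivAt (fun s => extChartAt (𝓡 n) p (γ s)) (chartD p (γ t) (velocity γ t)) t := by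
  have h0 := ((hc.contDiffAt_coord ht hp).differentiableAt (by simp)).hasDerivAt
  suffices h : chartD p (γ t) (velocity γ t) = deriv (fun s => extChartAt (𝓡 n) p (γ s)) t by
    rwa [h]
  rw [extChartAt_source] at hp
  have h3 := mfderiv_comp t (mdifferentiableAt_extChartAt (I := 𝓡 n) hp)
    ((hc.contMDiffAt ht).mdifferentiableAt (by simp))
  rw [mfderiv_eq_fderiv] at h3
  exact (congrArg (fun L => L (1 : ℝ)) h3).symm

lemma contDiffAt_coordField (hc : IsSmoothCurve n γ J) (hV : IsSmoothAlong γ J V) (ht : t ∈ J)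
    (hp : γ t ∈ (extChartAt (𝓡 n) p).source) : ContDiffAt ℝ ∞ (coordField p γ V) t := by
  have h := hV.contMDiffAt (hc.isOpen.mem_nhds ht)
  rw [Trivialization.contMDiffAt_iff (e := trivializationAt (Model n) (TangentSpace (𝓡 n)) p)
    (by rw [extChartAt_source] at hp; simpa [Trivialization.mem_source] using hp)] at h
  refine h.2.contDiffAt.congr_of_eventuallyEq ?_
  filter_upwards [hc.eventually_mem_source ht hp] with s hs
  exact chartD_eq_trivialization hs.2 _

lemma hasDerivAt_coordField (hc : IsSmoothCurve n γ J) (hV : IsSmoothAlong γ J V) (ht : t ∈ J)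
    (hp : γ t ∈ (extChartAt (𝓡 n) p).source) :
    HasDerivAt (coordField p γ V) (deriv (coordField p γ V) t) t :=
  ((hc.contDiffAt_coordField hV ht hp).differentiableAt (by simp)).hasDerivAt

lemma isSmoothAlong (hc : IsSmoothCurve n γ J)
    (h : ∀ t ∈ J, ContDiffAt ℝ ∞ (coordField (γ t) γ V) t) : IsSmoothAlong γ J V := by
  intro t ht
  refine ContMDiffAt.contMDiffWithinAt ?_
  have hp := mem_extChartAt_source (I := 𝓡 n) (γ t)
  rw [Trivialization.contMDiffAt_iff
    (e := trivializationAt (Model n) (TangentSpace (𝓡 n)) (γ t))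
    (by simp)]
  refine ⟨hc.contMDiffAt ht, ((h t ht).congr_of_eventuallyEq ?_).contMDiffAt⟩
  filter_upwards [hc.eventually_mem_source ht hp] with s hs
  exact (chartD_eq_trivialization hs.2 _).symm

lemma coordField_velocity (hc : IsSmoothCurve n γ J) (ht : t ∈ J)
    (hp : γ t ∈ (extChartAt (𝓡 n) p).source) :
    coordField p γ (velocity (n := n) γ) =ᶠ[nhds t] deriv (fun s => extChartAt (𝓡 n) p (γ s)) := by
  filter_upwards [hc.eventually_mem_source ht hp] with s hs
  exact (hc.hasDerivAt_coord hs.1 hs.2).deriv.symm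

lemma isSmoothAlong_velocity (hc : IsSmoothCurve n γ J) : IsSmoothAlong γ J (velocity (n := n) γ) := by
  refine hc.isSmoothAlong fun t ht => ?_
  have hp := mem_extChartAt_source (I := 𝓡 n) (γ t)
  refine ContDiffAt.congr_of_eventuallyEq ?_ (hc.coordField_velocity ht hp)
  exact contDiffAt_deriv (hc.contDiffAt_coord ht hp)

lemma isSmoothAlong_add (hc : IsSmoothCurve n γ J) (hV : IsSmoothAlong γ J V)
    (hW : IsSmoothAlong γ J W) : IsSmoothAlong γ J (fun t => V t + W t) := by
  refine hc.isSmoothAlong fun t ht => ?_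
  have hp := mem_extChartAt_source (I := 𝓡 n) (γ t)
  refine ((hc.contDiffAt_coordField hV ht hp).add
    (hc.contDiffAt_coordField hW ht hp)).congr_of_eventuallyEq (.of_forall fun s => ?_)
  exact map_add (chartD (γ t) (γ s)) _ _

lemma isSmoothAlong_smul (hc : IsSmoothCurve n γ J) {f : ℝ → ℝ} (hf : ContDiffOn ℝ ∞ f J)
    (hV : IsSmoothAlong γ J V) : IsSmoothAlong γ J (fun t => f t • V t) := by
  refine hc.isSmoothAlong fun t ht => ?_
  have hp := mem_extChartAt_source (I := 𝓡 n) (γ t)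
  refine ((hf.contDiffAt (hc.isOpen.mem_nhds ht)).smul
    (hc.contDiffAt_coordField hV ht hp)).congr_of_eventuallyEq (.of_forall fun s => ?_)
  exact map_smul (chartD (γ t) (γ s)) _ _

/-- The covariant derivative in an arbitrary chart. -/
lemma chartD_covDeriv (hc : IsSmoothCurve n γ J) (g : Metric n M) (hV : IsSmoothAlong γ J V)
    (ht : t ∈ J) (hp : γ t ∈ (extChartAt (𝓡 n) p).source) :
    chartD p (γ t) (covDeriv g γ V t) = deriv (coordField p γ V) t
      + christoffelCLM (coordMetric g p) (extChartAt (𝓡 n) p (γ t))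
        (chartD p (γ t) (velocity γ t)) (chartD p (γ t) (V t)) := by
  have h0 := mem_extChartAt_source (I := 𝓡 n) (γ t)
  have hφ := isIsometryOn_transition g (γ t) p
  have hd := mem_transitionDomain h0 hp
  have e1 : covDeriv g γ V t = deriv (coordField (γ t) γ V) t
      + christoffelCLM (coordMetric g (γ t)) (extChartAt (𝓡 n) (γ t) (γ t))
        (chartD (γ t) (γ t) (velocity γ t)) (chartD (γ t) (γ t) (V t)) := by
    rw [christoffelCLM_apply, chartD_self, chartD_self]
    rfl
  -- By the product rule, differentiating the transition of the coordinates of `V` yields a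
  -- second-derivative term; the inhomogeneous term in the law for the Christoffel symbols cancels
  -- it.
  have e2 : deriv (coordField p γ V) t =
      fderiv ℝ (fderiv ℝ (transition n (γ t) p)) (extChartAt (𝓡 n) (γ t) (γ t))
        (chartD (γ t) (γ t) (velocity γ t)) (chartD (γ t) (γ t) (V t))
      + fderiv ℝ (transition n (γ t) p) (extChartAt (𝓡 n) (γ t) (γ t))
        (deriv (coordField (γ t) γ V) t) := by
    have h1 := (((hφ.hasFDerivAt_fderiv hd).comp_hasDerivAt t
      (hc.hasDerivAt_coord ht h0)).clm_apply (hc.hasDerivAt_coordField hV ht h0))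
    have h2 := h1.congr_of_eventuallyEq (f₁ := coordField p γ V) <| by
      filter_upwards [hc.eventually_mem_source ht h0, hc.eventually_mem_source ht hp] with s hs hs'
      exact (fderiv_transition_chartD hs.2 hs'.2 (V s)).symm
    exact h2.deriv
  have e3 : chartD p (γ t) (covDeriv g γ V t) =
      fderiv ℝ (transition n (γ t) p) (extChartAt (𝓡 n) (γ t) (γ t)) (covDeriv g γ V t) := by
    rw [← fderiv_transition_chartD h0 hp, chartD_self]
  rw [e3, e1, map_add, hφ.christoffel hd, fderiv_transition_chartD h0 hp,
    fderiv_transition_chartD h0 hp, transition_extChartAt h0, e2]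
  abel

lemma isSmoothAlong_covDeriv (hc : IsSmoothCurve n γ J) (g : Metric n M)
    (hV : IsSmoothAlong γ J V) : IsSmoothAlong γ J (covDeriv g γ V) := by
  refine hc.isSmoothAlong fun t ht => ?_
  have hp := mem_extChartAt_source (I := 𝓡 n) (γ t)
  have hΓ := ((isMetricOn_coordMetric g (γ t)).contDiffAt_christoffelCLM
    ((extChartAt (𝓡 n) (γ t)).map_source hp)).comp t (hc.contDiffAt_coord ht hp)
  have hV' := hc.contDiffAt_coordField hV ht hp
  refine ContDiffAt.congr_of_eventuallyEq ((contDiffAt_deriv hV').add ((hΓ.clm_apply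
    (hc.contDiffAt_coordField hc.isSmoothAlong_velocity ht hp)).clm_apply hV')) ?_
  filter_upwards [hc.eventually_mem_source ht hp] with s hs
  exact hc.chartD_covDeriv g hV hs.1 hs.2

lemma contDiffOn_metric (hc : IsSmoothCurve n γ J) (g : Metric n M) (hV : IsSmoothAlong γ J V)
    (hW : IsSmoothAlong γ J W) : ContDiffOn ℝ ∞ (fun t => g.inner (γ t) (V t) (W t)) J := by
  intro t ht
  have hn := hc.isOpen.mem_nhds ht
  exact (contDiffAt_metric g (hV.contMDiffAt hn) (hW.contMDiffAt hn)).contDiffWithinAt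

lemma hasDerivAt_metric (hc : IsSmoothCurve n γ J) (g : Metric n M) (hV : IsSmoothAlong γ J V)
    (hW : IsSmoothAlong γ J W) (ht : t ∈ J) :
    HasDerivAt (fun t => g.inner (γ t) (V t) (W t))
      (g.inner (γ t) (covDeriv g γ V t) (W t) + g.inner (γ t) (V t) (covDeriv g γ W t)) t := by
  have hp := mem_extChartAt_source (I := 𝓡 n) (γ t)
  have hG := isMetricOn_coordMetric g (γ t)
  have hy := (extChartAt (𝓡 n) (γ t)).map_source hp
  have h1 := (((hG.hasFDerivAt hy).comp_hasDerivAt t (hc.hasDerivAt_coord ht hp)).clm_apply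
    (hc.hasDerivAt_coordField hV ht hp)).clm_apply (hc.hasDerivAt_coordField hW ht hp)
  have h2 := h1.congr_of_eventuallyEq (f₁ := fun t => g.inner (γ t) (V t) (W t)) <| by
    filter_upwards [hc.eventually_mem_source ht hp] with s hs
    exact (coordMetric_chartD g hs.2 (V s) (W s)).symm
  refine h2.congr_deriv ?_
  rw [← coordMetric_chartD g hp, ← coordMetric_chartD g hp, hc.chartD_covDeriv g hV ht hp,
    hc.chartD_covDeriv g hW ht hp]
  simp only [map_add, add_apply, hG.compatible hy, coordField, Function.comp_apply]
  ring

lemma covDeriv_add (hc : IsSmoothCurve n γ J) (g : Metric n M) (hV : IsSmoothAlong γ J V)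
    (hW : IsSmoothAlong γ J W) (ht : t ∈ J) :
    covDeriv g γ (fun t => V t + W t) t = covDeriv g γ V t + covDeriv g γ W t := by
  have hp := mem_extChartAt_source (I := 𝓡 n) (γ t)
  have e : deriv (coordField (γ t) γ (fun t => V t + W t)) t =
      deriv (coordField (γ t) γ V) t + deriv (coordField (γ t) γ W) t :=
    (((hc.hasDerivAt_coordField hV ht hp).add
      (hc.hasDerivAt_coordField hW ht hp)).congr_of_eventuallyEq
      (.of_forall fun s => map_add (chartD (γ t) (γ s)) _ _)).deriv
  apply chartD_injective hp
  rw [map_add, hc.chartD_covDeriv g hV ht hp, hc.chartD_covDeriv g hW ht hp,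
    hc.chartD_covDeriv g (hc.isSmoothAlong_add hV hW) ht hp, map_add, map_add, e]
  abel

lemma covDeriv_smul (hc : IsSmoothCurve n γ J) (g : Metric n M) {f : ℝ → ℝ}
    (hf : ContDiffOn ℝ ∞ f J) (hV : IsSmoothAlong γ J V) (ht : t ∈ J) :
    covDeriv g γ (fun t => f t • V t) t = deriv f t • V t + f t • covDeriv g γ V t := by
  have hp := mem_extChartAt_source (I := 𝓡 n) (γ t)
  have hf' := ((hf.contDiffAt (hc.isOpen.mem_nhds ht)).differentiableAt (by simp)).hasDerivAt
  have e : deriv (coordField (γ t) γ (fun t => f t • V t)) t =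
      f t • deriv (coordField (γ t) γ V) t + deriv f t • coordField (γ t) γ V t :=
    ((hf'.smul (hc.hasDerivAt_coordField hV ht hp)).congr_of_eventuallyEq
      (.of_forall fun s => map_smul (chartD (γ t) (γ s)) _ _)).deriv
  apply chartD_injective hp
  rw [map_add, map_smul, map_smul, hc.chartD_covDeriv g hV ht hp,
    hc.chartD_covDeriv g (hc.isSmoothAlong_smul hf hV) ht hp, map_smul, map_smul, e]
  simp only [coordField]
  module

/-- Near each parameter the chart is frozen at `γ t`, where the tensor is an explicit expression in
the metric, its inverse and the derivatives of the Christoffel symbols. -/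
lemma contDiffOn_schouten (hc : IsSmoothCurve n γ J) (g : Metric n M) (hV : IsSmoothAlong γ J V)
    (hW : IsSmoothAlong γ J W) : ContDiffOn ℝ ∞ (fun t => schouten g (γ t) (V t) (W t)) J := by
  intro t ht
  refine ContDiffAt.contDiffWithinAt ?_
  have hp := mem_extChartAt_source (I := 𝓡 n) (γ t)
  have hG := isMetricOn_coordMetric g (γ t)
  have hy := (extChartAt (𝓡 n) (γ t)).map_source hp
  have hx := hc.contDiffAt_coord ht hp
  have hVp := hc.contDiffAt_coordField hV ht hp
  have hWp := hc.contDiffAt_coordField hW ht hp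
  have hΓ := (hG.contDiffAt_christoffelCLM hy).comp t hx
  have hdΓ := ((hG.contDiffAt_christoffelCLM hy).fderiv_right (m := ∞) (by simp)).comp t hx
  have hcomp : ∀ {f : ℝ → Model n} (i : Fin n), ContDiffAt ℝ ∞ f t →
      ContDiffAt ℝ ∞ (fun s => f s i) t := fun i hf =>
    (EuclideanSpace.proj (𝕜 := ℝ) i).contDiff.contDiffAt.comp t hf
  have hric : ∀ {v w : ℝ → Model n}, ContDiffAt ℝ ∞ v t → ContDiffAt ℝ ∞ w t →
      ContDiffAt ℝ ∞ (fun s => ricciLin (christoffelCLM (coordMetric g (γ t)))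
        (extChartAt (𝓡 n) (γ t) (γ s)) (v s) (w s)) t := by
    intro v w hv hw
    simp only [ricciLin, LinearMap.mk₂_apply, curv]
    refine ContDiffAt.sum fun i _ => hcomp i ?_
    have hi : ContDiffAt ℝ ∞ (fun _ : ℝ => EuclideanSpace.single (𝕜 := ℝ) i (1 : ℝ)) t :=
      contDiffAt_const
    exact ((((hdΓ.clm_apply hi).clm_apply hv).clm_apply hw).sub
      (((hdΓ.clm_apply hv).clm_apply hi).clm_apply hw)).add
      ((hΓ.clm_apply hi).clm_apply ((hΓ.clm_apply hv).clm_apply hw)) |>.sub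
      ((hΓ.clm_apply hv).clm_apply ((hΓ.clm_apply hi).clm_apply hw))
  have hscal : ContDiffAt ℝ ∞ (fun s => ∑ j, ricciLin (christoffelCLM (coordMetric g (γ t)))
        (extChartAt (𝓡 n) (γ t) (γ s)) (raisedCoord (coordMetric g (γ t))
          (extChartAt (𝓡 n) (γ t) (γ s)) j) (EuclideanSpace.single j 1)) t :=
    ContDiffAt.sum fun j _ => hric
      (((hG.contDiffAt_inverse hy).comp t hx).clm_apply contDiffAt_const) contDiffAt_const
  refine ContDiffAt.congr_of_eventuallyEq (((hric hVp hWp).sub ((hscal.div_const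
    (2 * ((n : ℝ) - 1))).mul ((((hG.contDiffAt hy).comp t hx).clm_apply hVp).clm_apply
    hWp))).div_const ((n : ℝ) - 2)) ?_
  filter_upwards [hc.eventually_mem_source ht hp] with s hs
  have hys := (extChartAt (𝓡 n) (γ t)).map_source hs.2
  rw [schouten_eq_chart g hs.2, schoutenCoord, hG.ricci_eq hys, hG.scalarCurv_eq hys]
  rfl

end IsSmoothCurve

end Curves

/-! ### Pointwise algebra of the metric and the Schouten tensor -/

section Tensors

set_option linter.unusedSectionVars false

variable {n : ℕ} {M : Type*} [TopologicalSpace M] [ChartedSpace (Model n) M]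
  [IsManifold (𝓡 n) ∞ M]

lemma metric_ext (g : Metric n M) {x : M} {v w : TangentSpace (𝓡 n) x}
    (h : ∀ z, g.inner x v z = g.inner x w z) : v = w := by
  by_contra hne
  have := g.pos x (v - w) (sub_ne_zero.2 hne)
  rw [map_sub (g.inner x), sub_apply, h, sub_self] at this
  exact lt_irrefl _ this

lemma schouten_eq_lin (g : Metric n M) (x : M) (v w : TangentSpace (𝓡 n) x) :
    schouten g x v w = schoutenLin (coordMetric g x) (extChartAt (𝓡 n) x x) v w :=
  (isMetricOn_coordMetric g x).schouten_eq
    ((extChartAt (𝓡 n) x).map_source (mem_extChartAt_source x)) v w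

lemma schouten_smul_left (g : Metric n M) (x : M) (r : ℝ) (v w : TangentSpace (𝓡 n) x) :
    schouten g x (r • v) w = r * schouten g x v w := by
  simp only [schouten_eq_lin]
  exact LinearMap.map_smul₂ (schoutenLin (coordMetric g x) (extChartAt (𝓡 n) x x)) r v w

lemma schouten_smul_right (g : Metric n M) (x : M) (r : ℝ) (v w : TangentSpace (𝓡 n) x) :
    schouten g x v (r • w) = r * schouten g x v w := by
  simp only [schouten_eq_lin]
  exact map_smul (schoutenLin (coordMetric g x) (extChartAt (𝓡 n) x x) v) r w

lemma schouten_add_right (g : Metric n M) (x : M) (v w z : TangentSpace (𝓡 n) x) :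
    schouten g x v (w + z) = schouten g x v w + schouten g x v z := by
  simp only [schouten_eq_lin]
  exact map_add (schoutenLin (coordMetric g x) (extChartAt (𝓡 n) x x) v) w z

lemma metric_schoutenSharp (g : Metric n M) (x : M) (v w : TangentSpace (𝓡 n) x) :
    g.inner x (schoutenSharp g x v) w = schouten g x v w := by
  have hx := mem_extChartAt_source (I := 𝓡 n) x
  rw [← coordMetric_chartD g hx, chartD_self, chartD_self]
  exact (isMetricOn_coordMetric g x).metric_schoutenSharp ((extChartAt (𝓡 n) x).map_source hx) v w

lemma schoutenSharp_smul (g : Metric n M) (x : M) (r : ℝ) (v : TangentSpace (𝓡 n) x) :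
    schoutenSharp g x (r • v) = r • schoutenSharp g x v := by
  refine metric_ext g fun z => ?_
  rw [metric_schoutenSharp, schouten_smul_left, map_smul, smul_apply, metric_schoutenSharp,
    smul_eq_mul]

end Tensors

/-! ### Locality of the covariant derivative and the chain rule for reparametrizations -/

section Curves

set_option linter.unusedSectionVars false

variable {n : ℕ} {M : Type*} [TopologicalSpace M] [ChartedSpace (Model n) M]
  [IsManifold (𝓡 n) ∞ M]

variable {γ : ℝ → M} {J : Set ℝ} {V W : ∀ t, TangentSpace (𝓡 n) (γ t)} {t : ℝ}

namespace IsSmoothCurve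

lemma covDeriv_congr (hc : IsSmoothCurve n γ J) (g : Metric n M) (h : ∀ t ∈ J, V t = W t)
    (ht : t ∈ J) : covDeriv g γ V t = covDeriv g γ W t := by
  have e : ∀ V : ∀ t, TangentSpace (𝓡 n) (γ t), covDeriv g γ V t =
      deriv (coordField (γ t) γ V) t + christoffel (coordMetric g (γ t))
        (extChartAt (𝓡 n) (γ t) (γ t)) (velocity γ t) (V t) := fun _ => rfl
  have hd : deriv (coordField (γ t) γ V) t = deriv (coordField (γ t) γ W) t := by
    refine Filter.EventuallyEq.deriv_eq ?_
    filter_upwards [hc.isOpen.mem_nhds ht] with s hs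
    rw [coordField, coordField, h s hs]
  rw [e, e, hd, h t ht]

lemma isSmoothAlong_congr (hV : IsSmoothAlong γ J V) (h : ∀ t ∈ J, W t = V t) :
    IsSmoothAlong γ J W :=
  ContMDiffOn.congr hV fun t ht => by rw [h t ht]

lemma comp (hc : IsSmoothCurve n γ J) {K : Set ℝ} {h : ℝ → ℝ} (hK : IsOpen K)
    (hh : ContDiffOn ℝ ∞ h K) (hm : MapsTo h K J) : IsSmoothCurve n (γ ∘ h) K where
  isOpen := hK
  smooth := hc.smooth.comp (contMDiffOn_iff_contDiffOn.2 hh) hm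

lemma isSmoothAlong_comp (hV : IsSmoothAlong γ J V) {K : Set ℝ} {h : ℝ → ℝ}
    (hh : ContDiffOn ℝ ∞ h K) (hm : MapsTo h K J) :
    IsSmoothAlong (γ ∘ h) K (fun s => V (h s)) :=
  ContMDiffOn.comp (g := fun t => (⟨γ t, V t⟩ : TangentBundle (𝓡 n) M)) hV
    (contMDiffOn_iff_contDiffOn.2 hh) hm

lemma velocity_comp (hc : IsSmoothCurve n γ J) {h : ℝ → ℝ} {τ h' : ℝ}
    (hh : HasDerivAt h h' τ) (hτ : h τ ∈ J) :
    velocity (n := n) (γ ∘ h) τ = h' • velocity (n := n) γ (h τ) := by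
  have h1 : MDifferentiableAt 𝓘(ℝ, ℝ) (𝓡 n) γ (h τ) :=
    (hc.contMDiffAt hτ).mdifferentiableAt (by simp)
  have h2 := mfderiv_comp τ h1 hh.differentiableAt.mdifferentiableAt
  have h3 := congrArg (fun L => L (1 : ℝ)) h2
  refine Eq.trans h3 ?_
  rw [mfderiv_eq_fderiv]
  refine Eq.trans (congrArg (mfderiv 𝓘(ℝ, ℝ) (𝓡 n) γ (h τ))
    (?_ : fderiv ℝ h τ (1 : ℝ) = h' • (1 : ℝ))) (map_smul (mfderiv 𝓘(ℝ, ℝ) (𝓡 n) γ (h τ)) h' (1 : ℝ))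
  rw [hh.hasFDerivAt.fderiv]
  simp

/-- Both sides use the chart centred at `γ (h τ)`, so this is the ordinary chain rule plus linearity
of the Christoffel term in the velocity. -/
lemma covDeriv_comp (hc : IsSmoothCurve n γ J) (g : Metric n M) (hV : IsSmoothAlong γ J V)
    {h : ℝ → ℝ} {τ h' : ℝ} (hh : HasDerivAt h h' τ) (hτ : h τ ∈ J) :
    covDeriv g (γ ∘ h) (fun s => V (h s)) τ = h' • covDeriv g γ V (h τ) := by
  have hp := mem_extChartAt_source (I := 𝓡 n) (γ (h τ))
  have e1 : covDeriv g γ V (h τ) =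
      deriv (coordField (γ (h τ)) γ V) (h τ) + christoffel (coordMetric g (γ (h τ)))
        (extChartAt (𝓡 n) (γ (h τ)) (γ (h τ))) (velocity γ (h τ)) (V (h τ)) := rfl
  have e2 : covDeriv g (γ ∘ h) (fun s => V (h s)) τ =
      deriv (coordField (γ (h τ)) γ V ∘ h) τ + christoffel (coordMetric g (γ (h τ)))
        (extChartAt (𝓡 n) (γ (h τ)) (γ (h τ))) (velocity (γ ∘ h) τ) (V (h τ)) := rfl
  have e3 := ((hc.hasDerivAt_coordField hV hτ hp).scomp τ hh).deriv
  have e4 : ∀ u v : Model n, christoffel (coordMetric g (γ (h τ)))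
      (extChartAt (𝓡 n) (γ (h τ)) (γ (h τ))) (h' • u) v =
      h' • christoffel (coordMetric g (γ (h τ)))
        (extChartAt (𝓡 n) (γ (h τ)) (γ (h τ))) u v := fun u v => by
    rw [← christoffelCLM_apply, map_smul, smul_apply, christoffelCLM_apply]
  have e5 : christoffel (coordMetric g (γ (h τ))) (extChartAt (𝓡 n) (γ (h τ)) (γ (h τ)))
      (velocity (γ ∘ h) τ) (V (h τ)) = h' • christoffel (coordMetric g (γ (h τ)))
        (extChartAt (𝓡 n) (γ (h τ)) (γ (h τ))) (velocity γ (h τ)) (V (h τ)) :=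
    (congrArg (fun u : Model n => christoffel (coordMetric g (γ (h τ)))
      (extChartAt (𝓡 n) (γ (h τ)) (γ (h τ))) u (V (h τ))) (hc.velocity_comp hh hτ)).trans (e4 _ _)
  rw [e1, e2, e3, e5]
  exact (smul_add h' (deriv (coordField (γ (h τ)) γ V) (h τ)) (christoffel
    (coordMetric g (γ (h τ))) (extChartAt (𝓡 n) (γ (h τ)) (γ (h τ))) (velocity γ (h τ))
    (V (h τ)))).symm

end IsSmoothCurve

end Curves

/-! ### Conformal change of the metric along a curve -/

section Conformal

set_option linter.unusedSectionVars false

variable {n : ℕ} {M : Type*} [TopologicalSpace M] [ChartedSpace (Model n) M]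
  [IsManifold (𝓡 n) ∞ M]

/-- `g' = Ω² g` and `Y` is the `g`-gradient of `log Ω`. -/
structure IsRescaling (g' g : Metric n M) (Ω : M → ℝ) (Y : ∀ x : M, TangentSpace (𝓡 n) x) :
    Prop where
  smooth : ContMDiff (𝓡 n) 𝓘(ℝ, ℝ) ∞ Ω
  pos : ∀ x, 0 < Ω x
  eq : ∀ (x : M) (v w : TangentSpace (𝓡 n) x), g'.inner x v w = Ω x ^ 2 * g.inner x v w
  grad : ∀ (x : M) (v : TangentSpace (𝓡 n) x),
    Ω x * g.inner x (Y x) v = mfderiv (𝓡 n) 𝓘(ℝ, ℝ) Ω x v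

/-- The gradient of `log Ω` is chosen point by point by inverting the metric. Its smoothness is
recovered in `isRescalingOn`, since it is uniquely determined. -/
lemma IsConformalTo.exists_isRescaling {g' g : Metric n M} (h : IsConformalTo g' g) :
    ∃ Ω Y, IsRescaling g' g Ω Y := by
  obtain ⟨Ω, hΩ, hpos, heq⟩ := h
  have : ∀ x : M, ∃ Y : TangentSpace (𝓡 n) x, ∀ v : TangentSpace (𝓡 n) x,
      Ω x * g.inner x Y v = mfderiv (𝓡 n) 𝓘(ℝ, ℝ) Ω x v := by
    intro x
    let B : Model n →L[ℝ] Model n →L[ℝ] ℝ := g.inner x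
    let φ : Model n →L[ℝ] ℝ := mfderiv (𝓡 n) 𝓘(ℝ, ℝ) Ω x
    obtain ⟨e, he⟩ := isInvertible_of_pos (B := B) (g.pos x)
    refine ⟨e.symm ((Ω x)⁻¹ • φ), fun v => ?_⟩
    have h1 : B (e.symm ((Ω x)⁻¹ • φ)) = (Ω x)⁻¹ • φ := by
      rw [← he]; exact e.apply_symm_apply _
    have h2 : B (e.symm ((Ω x)⁻¹ • φ)) v = (Ω x)⁻¹ * φ v := by rw [h1]; rfl
    have h3 : Ω x * ((Ω x)⁻¹ * φ v) = φ v := by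
      have := (hpos x).ne'
      field_simp
    exact (congrArg (Ω x * ·) h2).trans h3
  choose Y hY using this
  exact ⟨Ω, Y, hΩ, hpos, heq, hY⟩

namespace IsRescaling

variable {g' g : Metric n M} {Ω : M → ℝ} {Y : ∀ x : M, TangentSpace (𝓡 n) x}

lemma isRescalingOn (h : IsRescaling g' g Ω Y) (p : M) :
    IsRescalingOn (coordMetric g' p) (coordMetric g p) (fun y => Ω ((extChartAt (𝓡 n) p).symm y))
      (fun y => chartD p _ (Y ((extChartAt (𝓡 n) p).symm y))) (extChartAt (𝓡 n) p).target := by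
  have hG := isMetricOn_coordMetric g p
  have hsm : ContDiffOn ℝ ∞ (fun y => Ω ((extChartAt (𝓡 n) p).symm y))
      (extChartAt (𝓡 n) p).target :=
    contMDiffOn_iff_contDiffOn.1 (h.smooth.comp_contMDiffOn (contMDiffOn_extChartAt_symm p))
  have hgrad : ∀ y ∈ (extChartAt (𝓡 n) p).target, ∀ v,
      Ω ((extChartAt (𝓡 n) p).symm y) *
        coordMetric g p y (chartD p _ (Y ((extChartAt (𝓡 n) p).symm y))) v =
      fderiv ℝ (fun y => Ω ((extChartAt (𝓡 n) p).symm y)) y v := by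
    intro y hy v
    rw [coordMetric_apply, chartDSymm_chartD hy, h.grad]
    have h1 : MDifferentiableAt 𝓘(ℝ, Model n) (𝓡 n) (extChartAt (𝓡 n) p).symm y := by
      have := mdifferentiableWithinAt_extChartAt_symm (I := 𝓡 n) hy
      rwa [ModelWithCorners.range_eq_univ, mdifferentiableWithinAt_univ] at this
    have h3 := mfderiv_comp y ((h.smooth _).mdifferentiableAt (by simp)) h1
    rw [mfderiv_eq_fderiv] at h3
    exact (congrArg (fun L => L v) h3).symm
  refine ⟨isMetricOn_coordMetric g' p, hG, hsm, ?_, fun y _ => h.pos _, fun y _ v w => h.eq _ _ _,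
    hgrad⟩
  -- The explicit gradient formula is visibly smooth, and it agrees with the coordinates of `Y` by
  -- nondegeneracy.
  have hsm2 : ContDiffOn ℝ ∞ (fun y => (coordMetric g p y).inverse
      ((Ω ((extChartAt (𝓡 n) p).symm y))⁻¹ •
        fderiv ℝ (fun y => Ω ((extChartAt (𝓡 n) p).symm y)) y)) (extChartAt (𝓡 n) p).target := by
    intro y hy
    have hΩ := hsm.contDiffAt (hG.isOpen.mem_nhds hy)
    exact ((hG.contDiffAt_inverse hy).clm_apply ((hΩ.inv (h.pos _).ne').smul
      (hΩ.fderiv_right (m := ∞) (by simp)))).contDiffWithinAt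
  refine hsm2.congr fun y hy => hG.ext_left hy fun z => ?_
  have := (h.pos ((extChartAt (𝓡 n) p).symm y)).ne'
  rw [hG.apply_inverse hy, smul_apply, ← hgrad y hy, smul_eq_mul]
  field_simp

variable {γ : ℝ → M} {J : Set ℝ} {V W : ∀ t, TangentSpace (𝓡 n) (γ t)} {t : ℝ}

lemma coordField_grad (hc : IsSmoothCurve n γ J) {p : M} (ht : t ∈ J)
    (hp : γ t ∈ (extChartAt (𝓡 n) p).source) : coordField p γ (fun t => Y (γ t)) =ᶠ[nhds t]
      fun s => (fun y => chartD p _ (Y ((extChartAt (𝓡 n) p).symm y)) : Model n → Model n)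
        (extChartAt (𝓡 n) p (γ s)) := by
  filter_upwards [hc.eventually_mem_source ht hp] with s hs
  show chartD p _ _ = chartD p _ _
  rw [(extChartAt (𝓡 n) p).left_inv hs.2]

lemma isSmoothAlong_grad (h : IsRescaling g' g Ω Y) (hc : IsSmoothCurve n γ J) :
    IsSmoothAlong γ J (fun t => Y (γ t)) := by
  refine hc.isSmoothAlong fun t ht => ?_
  have hp := mem_extChartAt_source (I := 𝓡 n) (γ t)
  have hR := h.isRescalingOn (γ t)
  refine ContDiffAt.congr_of_eventuallyEq ?_ (coordField_grad hc ht hp)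
  exact (hR.smooth_grad.contDiffAt (hR.left.isOpen.mem_nhds
    ((extChartAt (𝓡 n) (γ t)).map_source hp))).comp t (hc.contDiffAt_coord ht hp)

lemma covDeriv (h : IsRescaling g' g Ω Y) (hc : IsSmoothCurve n γ J) (hV : IsSmoothAlong γ J V)
    (ht : t ∈ J) :
    covDeriv g' γ V t = covDeriv g γ V t + g.inner (γ t) (Y (γ t)) (velocity γ t) • V t
      + g.inner (γ t) (Y (γ t)) (V t) • velocity γ t
      - g.inner (γ t) (velocity γ t) (V t) • Y (γ t) := by
  have hp := mem_extChartAt_source (I := 𝓡 n) (γ t)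
  have hy := (extChartAt (𝓡 n) (γ t)).map_source hp
  apply chartD_injective hp
  have hY : chartD (γ t) ((extChartAt (𝓡 n) (γ t)).symm (extChartAt (𝓡 n) (γ t) (γ t)))
      (Y ((extChartAt (𝓡 n) (γ t)).symm (extChartAt (𝓡 n) (γ t) (γ t)))) =
      chartD (γ t) (γ t) (Y (γ t)) := by
    rw [(extChartAt (𝓡 n) (γ t)).left_inv hp]
  rw [hc.chartD_covDeriv g' hV ht hp, (h.isRescalingOn (γ t)).christoffel hy, hY,
    coordMetric_chartD g hp, coordMetric_chartD g hp, coordMetric_chartD g hp,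
    map_sub, map_add, map_add, map_smul, map_smul, map_smul, hc.chartD_covDeriv g hV ht hp]
  abel

/-- With the velocity as first argument, the Hessian term only involves the covariant derivative of
`Y` along the curve, so `Y` never has to be differentiated off it. -/
lemma schouten (h : IsRescaling g' g Ω Y) (hn : 3 ≤ n) (hc : IsSmoothCurve n γ J) (ht : t ∈ J)
    (w : TangentSpace (𝓡 n) (γ t)) :
    schouten g' (γ t) (velocity γ t) w = schouten g (γ t) (velocity γ t) w
      - g.inner (γ t) (ConformalCurves.covDeriv g γ (fun t => Y (γ t)) t) w
      + g.inner (γ t) (Y (γ t)) (velocity γ t) * g.inner (γ t) (Y (γ t)) w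
      - 1 / 2 * g.inner (γ t) (Y (γ t)) (Y (γ t)) * g.inner (γ t) (velocity γ t) w := by
  have hp := mem_extChartAt_source (I := 𝓡 n) (γ t)
  have hy := (extChartAt (𝓡 n) (γ t)).map_source hp
  have hR := h.isRescalingOn (γ t)
  have hY : chartD (γ t) ((extChartAt (𝓡 n) (γ t)).symm (extChartAt (𝓡 n) (γ t) (γ t)))
      (Y ((extChartAt (𝓡 n) (γ t)).symm (extChartAt (𝓡 n) (γ t) (γ t)))) =
      chartD (γ t) (γ t) (Y (γ t)) := by
    rw [(extChartAt (𝓡 n) (γ t)).left_inv hp]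
  have e := ((hR.hasFDerivAt_grad hy).comp_hasDerivAt t
    (hc.hasDerivAt_coord ht hp)).congr_of_eventuallyEq (coordField_grad hc ht hp)
  have hH : hR.hess (extChartAt (𝓡 n) (γ t) (γ t)) (chartD (γ t) (γ t) (velocity γ t)) =
      chartD (γ t) (γ t) (ConformalCurves.covDeriv g γ (fun t => Y (γ t)) t) := by
    rw [hc.chartD_covDeriv g (h.isSmoothAlong_grad hc) ht hp, hR.hess_apply, e.deriv, hY]
  rw [schouten_eq_chart g' hp, schouten_eq_chart g hp, hR.schouten hn hy, hH, hY,
    coordMetric_chartD g hp, coordMetric_chartD g hp, coordMetric_chartD g hp,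
    coordMetric_chartD g hp, coordMetric_chartD g hp]

end IsRescaling

end Conformal

/-! ### The ordinary differential equation for the parameter -/

/-- Local solvability of `h''' = 3/2 h''² / h' - h'³ F(h)` with `h' ≠ 0`. -/
lemma exists_reparametrization {J : Set ℝ} (hJ : IsOpen J) {F : ℝ → ℝ} (hF : ContDiffOn ℝ ∞ F J)
    {t₀ : ℝ} (ht₀ : t₀ ∈ J) :
    ∃ (K : Set ℝ) (h h₁ h₂ : ℝ → ℝ), IsOpen K ∧ K.OrdConnected ∧ ContDiffOn ℝ ∞ h K ∧
      MapsTo h K J ∧ t₀ ∈ h '' K ∧ ∀ τ ∈ K, h₁ τ ≠ 0 ∧ HasDerivAt h (h₁ τ) τ ∧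
        HasDerivAt h₁ (h₂ τ) τ ∧
        HasDerivAt h₂ (3 / 2 * h₂ τ ^ 2 / h₁ τ - h₁ τ ^ 3 * F (h τ)) τ := by
  -- The equation as a first-order system for `(h, h', h'')`. The initial value `(t₀, 1, 0)` makes
  -- the change of parameter regular at `t₀`.
  let v : ℝ × ℝ × ℝ → ℝ × ℝ × ℝ := fun x =>
    (x.2.1, x.2.2, 3 / 2 * x.2.2 ^ 2 / x.2.1 - x.2.1 ^ 3 * F x.1)
  let s : Set (ℝ × ℝ × ℝ) := {x | x.1 ∈ J ∧ x.2.1 ≠ 0}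
  have hs : IsOpen s := (hJ.preimage continuous_fst).inter
    (isOpen_ne.preimage (continuous_fst.comp continuous_snd))
  have hv : ContDiffOn ℝ ∞ v s := by
    have h1 : ContDiffOn ℝ ∞ (fun x : ℝ × ℝ × ℝ => F x.1) s :=
      hF.comp contDiffOn_fst fun x hx => hx.1
    have h2 : ContDiffOn ℝ ∞ (fun x : ℝ × ℝ × ℝ => x.2.1) s :=
      (contDiff_fst.comp contDiff_snd).contDiffOn
    have h3 : ContDiffOn ℝ ∞ (fun x : ℝ × ℝ × ℝ => x.2.2) s :=
      (contDiff_snd.comp contDiff_snd).contDiffOn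
    exact h2.prodMk (h3.prodMk (((contDiffOn_const.mul (h3.pow 2)).div h2 fun x hx => hx.2).sub
      ((h2.pow 3).mul h1)))
  have hx₀ : (t₀, (1 : ℝ), (0 : ℝ)) ∈ s := ⟨ht₀, one_ne_zero⟩
  have hv1 : ContDiffAt ℝ 1 v (t₀, 1, 0) :=
    (hv.contDiffAt (hs.mem_nhds hx₀)).of_le (by simp)
  obtain ⟨α, hα0, ε, hε, hα⟩ :=
    hv1.exists_forall_mem_closedBall_exists_eq_forall_mem_Ioo_hasDerivAt₀ 0
  have hcont : ContinuousAt α 0 := (hα 0 (by simp [hε])).continuousAt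
  have hmem : ∀ᶠ τ in nhds (0 : ℝ), α τ ∈ s :=
    hcont.eventually (hs.mem_nhds (by rw [hα0]; exact hx₀))
  obtain ⟨δ, hδ, hball⟩ := Metric.eventually_nhds_iff_ball.1 hmem
  set K : Set ℝ := Ioo (-(min δ ε)) (min δ ε) with hK
  have hKpos : 0 < min δ ε := lt_min hδ hε
  have hKs : ∀ τ ∈ K, α τ ∈ s := fun τ hτ => hball τ <| by
    rw [Metric.mem_ball, Real.dist_eq, sub_zero, abs_lt]
    exact ⟨by linarith [hτ.1, min_le_left δ ε], by linarith [hτ.2, min_le_left δ ε]⟩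
  have hKd : ∀ τ ∈ K, HasDerivAt α (v (α τ)) τ := fun τ hτ => hα τ
    ⟨by linarith [hτ.1, min_le_right δ ε], by linarith [hτ.2, min_le_right δ ε]⟩
  -- Bootstrapping: if `α` is `C^m`, then so is its derivative `v ∘ α`, and `α` is `C^(m+1)`.
  have hsm : ContDiffOn ℝ ∞ α K := by
    rw [contDiffOn_infty]
    intro m
    induction m with
    | zero =>
      exact contDiffOn_zero.2 fun τ hτ => (hKd τ hτ).continuousAt.continuousWithinAt
    | succ m ih =>
      rw [Nat.cast_succ, contDiffOn_succ_iff_deriv_of_isOpen isOpen_Ioo]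
      refine ⟨fun τ hτ => (hKd τ hτ).differentiableAt.differentiableWithinAt, by simp, ?_⟩
      exact ((hv.of_le (by exact_mod_cast le_top)).comp ih hKs).congr fun τ hτ => (hKd τ hτ).deriv
  refine ⟨K, fun τ => (α τ).1, fun τ => (α τ).2.1, fun τ => (α τ).2.2, isOpen_Ioo, ordConnected_Ioo,
    contDiff_fst.comp_contDiffOn hsm, fun τ hτ => (hKs τ hτ).1,
    ⟨0, ⟨by linarith, hKpos⟩, by simp [hα0]⟩, fun τ hτ => ⟨(hKs τ hτ).2, ?_, ?_, ?_⟩⟩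
  · exact (hKd τ hτ).fst
  · exact (hKd τ hτ).snd.fst
  · exact (hKd τ hτ).snd.snd

/-! ### The obstruction vector and its conformal invariance modulo the tangent -/

section Obstruction

set_option linter.unusedSectionVars false

variable {n : ℕ} {M : Type*} [TopologicalSpace M] [ChartedSpace (Model n) M]
  [IsManifold (𝓡 n) ∞ M]

/-- The acceleration `U' = ∇_U U`. -/
def accel (g : Metric n M) (γ : ℝ → M) : ∀ t, TangentSpace (𝓡 n) (γ t) :=
  covDeriv g γ (velocity γ)

/-- The vector `U'' - 3u⁻²⟨U,U'⟩U' - u² UᶜP_cᵃ`, which is tangent to the curve precisely at the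
vertices. -/
def obstruction (g : Metric n M) (γ : ℝ → M) (t : ℝ) : TangentSpace (𝓡 n) (γ t) :=
  covDeriv g γ (accel g γ) t
    - (3 * (g.inner (γ t) (velocity γ t) (velocity γ t))⁻¹
      * g.inner (γ t) (velocity γ t) (accel g γ t)) • accel g γ t
    - g.inner (γ t) (velocity γ t) (velocity γ t) • schoutenSharp g (γ t) (velocity γ t)

/-- The obstruction is tangent to the curve at each parameter in `J`. -/
def IsTangential (g : Metric n M) (γ : ℝ → M) (J : Set ℝ) : Prop :=
  ∀ t ∈ J, ∃ k : ℝ, obstruction g γ t = k • velocity γ t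

variable {γ : ℝ → M} {J : Set ℝ} {t : ℝ}

lemma IsSmoothCurve.isSmoothAlong_accel (hc : IsSmoothCurve n γ J) (g : Metric n M) :
    IsSmoothAlong γ J (accel g γ) :=
  hc.isSmoothAlong_covDeriv g hc.isSmoothAlong_velocity

lemma IsRescaling.accel {g' g : Metric n M} {Ω : M → ℝ} {Y : ∀ x : M, TangentSpace (𝓡 n) x}
    (h : IsRescaling g' g Ω Y) (hc : IsSmoothCurve n γ J) (ht : t ∈ J) :
    accel g' γ t = ConformalCurves.accel g γ t
      + (2 * g.inner (γ t) (Y (γ t)) (velocity γ t)) • velocity γ t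
      + (-g.inner (γ t) (velocity γ t) (velocity γ t)) • Y (γ t) := by
  rw [ConformalCurves.accel, h.covDeriv hc hc.isSmoothAlong_velocity ht, ConformalCurves.accel]
  module

/-- Differentiates the law for `accel` with the old connection. The coefficient of the velocity
stays unspecified, because only the class modulo the tangent matters. -/
lemma IsRescaling.covDeriv_accel {g' g : Metric n M} {Ω : M → ℝ}
    {Y : ∀ x : M, TangentSpace (𝓡 n) x} (h : IsRescaling g' g Ω Y) (hc : IsSmoothCurve n γ J)
    (ht : t ∈ J) : ∃ k : ℝ, ConformalCurves.covDeriv g γ (ConformalCurves.accel g' γ) t =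
      ConformalCurves.covDeriv g γ (ConformalCurves.accel g γ) t
      + (2 * g.inner (γ t) (Y (γ t)) (velocity γ t)) • ConformalCurves.accel g γ t
      + k • velocity γ t
      - (2 * g.inner (γ t) (velocity γ t) (ConformalCurves.accel g γ t)) • Y (γ t)
      - g.inner (γ t) (velocity γ t) (velocity γ t) •
        ConformalCurves.covDeriv g γ (fun t => Y (γ t)) t := by
  have hU := hc.isSmoothAlong_velocity (n := n)
  have hA := hc.isSmoothAlong_accel g
  have hY := h.isSmoothAlong_grad hc
  have hk : ContDiffOn ℝ ∞ (fun t => 2 * g.inner (γ t) (Y (γ t)) (velocity γ t)) J :=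
    contDiffOn_const.mul (hc.contDiffOn_metric g hY hU)
  have hq : ContDiffOn ℝ ∞ (fun t => -g.inner (γ t) (velocity γ t) (velocity γ t)) J :=
    (hc.contDiffOn_metric g hU hU).neg
  have hq' : deriv (fun t => -g.inner (γ t) (velocity γ t) (velocity γ t)) t =
      -(2 * g.inner (γ t) (velocity γ t) (ConformalCurves.accel g γ t)) := by
    rw [(hc.hasDerivAt_metric g hU hU ht).fun_neg.deriv, g.symm _ (ConformalCurves.covDeriv g γ _ t),
      ConformalCurves.accel]
    ring
  have hkU := hc.isSmoothAlong_smul hk hU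
  refine ⟨deriv (fun t => 2 * g.inner (γ t) (Y (γ t)) (velocity γ t)) t, ?_⟩
  rw [hc.covDeriv_congr g (fun s hs => h.accel hc hs) ht,
    hc.covDeriv_add g (hc.isSmoothAlong_add hA hkU) (hc.isSmoothAlong_smul hq hY) ht,
    hc.covDeriv_add g hA hkU ht, hc.covDeriv_smul g hk hU ht, hc.covDeriv_smul g hq hY ht, hq',
    ConformalCurves.accel]
  module

/-- The factor `Ω²` compensates for raising the index with `g'` instead of `g`. -/
lemma IsRescaling.schoutenSharp {g' g : Metric n M} {Ω : M → ℝ}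
    {Y : ∀ x : M, TangentSpace (𝓡 n) x} (h : IsRescaling g' g Ω Y) (hn : 3 ≤ n)
    (hc : IsSmoothCurve n γ J) (ht : t ∈ J) :
    Ω (γ t) ^ 2 • schoutenSharp g' (γ t) (velocity γ t) =
      ConformalCurves.schoutenSharp g (γ t) (velocity γ t)
      - ConformalCurves.covDeriv g γ (fun t => Y (γ t)) t
      + g.inner (γ t) (Y (γ t)) (velocity γ t) • Y (γ t)
      - (1 / 2 * g.inner (γ t) (Y (γ t)) (Y (γ t))) • velocity γ t := by
  refine metric_ext g fun z => ?_
  rw [map_smul, smul_apply, smul_eq_mul, ← h.eq, metric_schoutenSharp, h.schouten hn hc ht]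
  simp only [map_sub, map_add, map_smul, sub_apply, add_apply, smul_apply, smul_eq_mul,
    metric_schoutenSharp]

/-- The new terms cancel by kind: `∇_U Y` between `U''` and the Schouten vector; `3⟨Y,U⟩U'` between
`U''` and the term with `3u⁻²⟨U,U'⟩`; and the multiples of `Y` among all three. Only multiples of
the velocity survive. -/
lemma IsRescaling.obstruction {g' g : Metric n M} {Ω : M → ℝ}
    {Y : ∀ x : M, TangentSpace (𝓡 n) x} (h : IsRescaling g' g Ω Y) (hn : 3 ≤ n)
    (hc : IsSmoothCurve n γ J) (ht : t ∈ J) (hreg : velocity (n := n) γ t ≠ 0) :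
    ∃ k : ℝ, obstruction g' γ t = ConformalCurves.obstruction g γ t + k • velocity γ t := by
  obtain ⟨k, hk⟩ := h.covDeriv_accel hc ht
  have hq := (g.pos (γ t) _ hreg).ne'
  have hΩ := (h.pos (γ t)).ne'
  have hS := h.schoutenSharp hn hc ht
  have hA := h.accel hc ht
  have e1 : g'.inner (γ t) (velocity γ t) (velocity γ t) • ConformalCurves.schoutenSharp g' (γ t)
      (velocity γ t) = g.inner (γ t) (velocity γ t) (velocity γ t) •
        (Ω (γ t) ^ 2 • ConformalCurves.schoutenSharp g' (γ t) (velocity γ t)) := by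
    rw [h.eq, smul_smul, mul_comm]
  have e2 : 3 * (g'.inner (γ t) (velocity γ t) (velocity γ t))⁻¹
      * g'.inner (γ t) (velocity γ t) (ConformalCurves.accel g' γ t) =
      3 * (g.inner (γ t) (velocity γ t) (velocity γ t))⁻¹ *
        (g.inner (γ t) (velocity γ t) (ConformalCurves.accel g γ t)
          + g.inner (γ t) (Y (γ t)) (velocity γ t) *
            g.inner (γ t) (velocity γ t) (velocity γ t)) := by
    rw [h.eq, h.eq, hA, map_add, map_add, map_smul, map_smul, smul_eq_mul, smul_eq_mul,
      g.symm _ (velocity γ t) (Y (γ t))]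
    field_simp
    ring
  have e3 : g.inner (γ t) (velocity γ t) (ConformalCurves.accel g' γ t) =
      g.inner (γ t) (velocity γ t) (ConformalCurves.accel g γ t)
          + g.inner (γ t) (Y (γ t)) (velocity γ t) *
            g.inner (γ t) (velocity γ t) (velocity γ t) := by
    rw [hA, map_add, map_add, map_smul, map_smul, smul_eq_mul, smul_eq_mul,
      g.symm _ (velocity γ t) (Y (γ t))]
    ring
  -- The sum of the velocity coefficients from the two covariant derivatives, the new acceleration
  -- and the Schouten vector.
  refine ⟨k + 2 * g.inner (γ t) (Y (γ t)) (velocity γ t) ^ 2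
    + g.inner (γ t) (Y (γ t)) (ConformalCurves.accel g' γ t)
    - 3 * (g.inner (γ t) (velocity γ t) (velocity γ t))⁻¹ *
        (g.inner (γ t) (velocity γ t) (ConformalCurves.accel g γ t)
          + g.inner (γ t) (Y (γ t)) (velocity γ t) *
            g.inner (γ t) (velocity γ t) (velocity γ t))
      * (2 * g.inner (γ t) (Y (γ t)) (velocity γ t))
    + g.inner (γ t) (velocity γ t) (velocity γ t) *
      (1 / 2 * g.inner (γ t) (Y (γ t)) (Y (γ t))), ?_⟩
  rw [ConformalCurves.obstruction, ConformalCurves.obstruction,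
    h.covDeriv hc (hc.isSmoothAlong_accel g') ht, hk, e1, e2, hS, e3]
  generalize g.inner (γ t) (Y (γ t)) (ConformalCurves.accel g' γ t) = c
  rw [hA]
  generalize g.inner (γ t) (velocity γ t) (velocity γ t) = q at *
  match_scalars <;> field_simp <;> ring

lemma IsTangential.of_isConformalTo {g' g : Metric n M} (h : IsConformalTo g' g) (hn : 3 ≤ n)
    (hc : IsSmoothCurve n γ J) (hreg : ∀ t ∈ J, velocity (n := n) γ t ≠ 0)
    (hg : IsTangential g γ J) : IsTangential g' γ J := by
  obtain ⟨Ω, Y, hR⟩ := h.exists_isRescaling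
  intro t ht
  obtain ⟨k, hk⟩ := hR.obstruction hn hc ht (hreg t ht)
  obtain ⟨l, hl⟩ := hg t ht
  exact ⟨l + k, by rw [hk, hl, add_smul]⟩

end Obstruction

/-! ### Reparametrization and the circle equation -/

section Reparametrization

set_option linter.unusedSectionVars false

variable {n : ℕ} {M : Type*} [TopologicalSpace M] [ChartedSpace (Model n) M]
  [IsManifold (𝓡 n) ∞ M] {γ : ℝ → M} {J K : Set ℝ} {h h₁ h₂ h₃ : ℝ → ℝ}

/-- `h : K → J` is smooth with first three derivatives `h₁`, `h₂`, `h₃`, and `h₁ ≠ 0`. -/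
structure IsReparametrization (J K : Set ℝ) (h h₁ h₂ h₃ : ℝ → ℝ) : Prop where
  isOpen : IsOpen K
  smooth : ContDiffOn ℝ ∞ h K
  mapsTo : MapsTo h K J
  ne_zero : ∀ τ ∈ K, h₁ τ ≠ 0
  first : ∀ τ ∈ K, HasDerivAt h (h₁ τ) τ
  second : ∀ τ ∈ K, HasDerivAt h₁ (h₂ τ) τ
  third : ∀ τ ∈ K, HasDerivAt h₂ (h₃ τ) τ

namespace IsReparametrization

lemma smooth_first (hh : IsReparametrization J K h h₁ h₂ h₃) : ContDiffOn ℝ ∞ h₁ K :=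
  (hh.smooth.deriv_of_isOpen (m := ∞) hh.isOpen (by simp)).congr
    fun τ hτ => (hh.first τ hτ).deriv.symm

lemma smooth_second (hh : IsReparametrization J K h h₁ h₂ h₃) : ContDiffOn ℝ ∞ h₂ K :=
  (hh.smooth_first.deriv_of_isOpen (m := ∞) hh.isOpen (by simp)).congr
    fun τ hτ => (hh.second τ hτ).deriv.symm

lemma curve (hh : IsReparametrization J K h h₁ h₂ h₃) (hc : IsSmoothCurve n γ J) :
    IsSmoothCurve n (γ ∘ h) K :=
  hc.comp hh.isOpen hh.smooth hh.mapsTo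

lemma velocity (hh : IsReparametrization J K h h₁ h₂ h₃) (hc : IsSmoothCurve n γ J) {τ : ℝ}
    (hτ : τ ∈ K) : velocity (n := n) (γ ∘ h) τ = h₁ τ • ConformalCurves.velocity (n := n) γ (h τ) :=
  hc.velocity_comp (hh.first τ hτ) (hh.mapsTo hτ)

lemma accel (hh : IsReparametrization J K h h₁ h₂ h₃) (hc : IsSmoothCurve n γ J)
    (g : Metric n M) {τ : ℝ} (hτ : τ ∈ K) :
    accel g (γ ∘ h) τ = h₂ τ • ConformalCurves.velocity (n := n) γ (h τ)
      + h₁ τ ^ 2 • ConformalCurves.accel g γ (h τ) := by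
  have hU := IsSmoothCurve.isSmoothAlong_comp (hc.isSmoothAlong_velocity (n := n)) hh.smooth
    hh.mapsTo
  rw [ConformalCurves.accel, (hh.curve hc).covDeriv_congr g (fun s hs => hh.velocity hc hs) hτ,
    (hh.curve hc).covDeriv_smul g hh.smooth_first hU hτ, (hh.second τ hτ).deriv,
    hc.covDeriv_comp g hc.isSmoothAlong_velocity (hh.first τ hτ) (hh.mapsTo hτ), smul_smul, ← sq]
  rfl

lemma covDeriv_accel (hh : IsReparametrization J K h h₁ h₂ h₃) (hc : IsSmoothCurve n γ J)
    (g : Metric n M) {τ : ℝ} (hτ : τ ∈ K) :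
    covDeriv g (γ ∘ h) (ConformalCurves.accel g (γ ∘ h)) τ =
      h₃ τ • ConformalCurves.velocity (n := n) γ (h τ)
      + (3 * h₁ τ * h₂ τ) • ConformalCurves.accel g γ (h τ)
      + h₁ τ ^ 3 • covDeriv g γ (ConformalCurves.accel g γ) (h τ) := by
  have hU := IsSmoothCurve.isSmoothAlong_comp (hc.isSmoothAlong_velocity (n := n)) hh.smooth
    hh.mapsTo
  have hA := IsSmoothCurve.isSmoothAlong_comp (hc.isSmoothAlong_accel g) hh.smooth hh.mapsTo
  have hc' := hh.curve hc
  have h2 : ContDiffOn ℝ ∞ (fun τ => h₁ τ ^ 2) K := hh.smooth_first.pow 2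
  have e2 : deriv (fun τ => h₁ τ ^ 2) τ = 2 * h₁ τ * h₂ τ := by
    rw [((hh.second τ hτ).fun_pow 2).deriv]
    simp
  have e3 := hc.covDeriv_comp g hc.isSmoothAlong_velocity (hh.first τ hτ) (hh.mapsTo hτ)
  have e4 := hc.covDeriv_comp g (hc.isSmoothAlong_accel g) (hh.first τ hτ) (hh.mapsTo hτ)
  rw [hc'.covDeriv_congr g (fun s hs => hh.accel hc g hs) hτ,
    hc'.covDeriv_add g (hc'.isSmoothAlong_smul hh.smooth_second hU) (hc'.isSmoothAlong_smul h2 hA)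
      hτ, hc'.covDeriv_smul g hh.smooth_second hU hτ, hc'.covDeriv_smul g h2 hA hτ, e2, e3, e4,
    (hh.third τ hτ).deriv]
  have key : ∀ u a b : TangentSpace (𝓡 n) (γ (h τ)),
      h₃ τ • u + h₂ τ • h₁ τ • a + ((2 * h₁ τ * h₂ τ) • a + h₁ τ ^ 2 • h₁ τ • b) =
        h₃ τ • u + (3 * h₁ τ * h₂ τ) • a + h₁ τ ^ 3 • b := fun u a b => by module
  exact key _ _ _

/-- The terms `3h'h''U'` cancel against the change of `3u⁻²⟨U,U'⟩U'`, so the second and third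
derivatives of `h` enter only through the velocity coefficient, as `h'` times the Schwarzian
derivative. -/
lemma solves_iff (hh : IsReparametrization J K h h₁ h₂ h₃) (hc : IsSmoothCurve n γ J)
    (hreg : ∀ t ∈ J, ConformalCurves.velocity (n := n) γ t ≠ 0)
    (g : Metric n M) {τ : ℝ} (hτ : τ ∈ K) :
    SolvesCircleEquationAt g (γ ∘ h) τ ↔
      h₁ τ ^ 3 • obstruction g γ (h τ) + (h₃ τ - 3 / 2 * h₂ τ ^ 2 / h₁ τ
        + h₁ τ ^ 3 * (3 / 2 * (g.inner (γ (h τ)) (ConformalCurves.velocity γ (h τ))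
            (ConformalCurves.velocity γ (h τ)))⁻¹
          * g.inner (γ (h τ)) (ConformalCurves.accel g γ (h τ)) (ConformalCurves.accel g γ (h τ))
          + 2 * schouten g (γ (h τ)) (ConformalCurves.velocity γ (h τ))
            (ConformalCurves.velocity γ (h τ)))) • ConformalCurves.velocity γ (h τ) = 0 := by
  have h1 := hh.ne_zero τ hτ
  have hq := (g.pos (γ (h τ)) _ (hreg _ (hh.mapsTo hτ))).ne'
  have e : ∀ u a b : TangentSpace (𝓡 n) (γ (h τ)), ConformalCurves.velocity (γ ∘ h) τ = u →
      ConformalCurves.accel g (γ ∘ h) τ = a →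
      covDeriv g (γ ∘ h) (ConformalCurves.accel g (γ ∘ h)) τ = b →
      (SolvesCircleEquationAt g (γ ∘ h) τ ↔
        b = (3 * (g.inner (γ (h τ)) u u)⁻¹ * g.inner (γ (h τ)) u a) • a
          - (3 / 2 * (g.inner (γ (h τ)) u u)⁻¹ * g.inner (γ (h τ)) a a) • u
          + g.inner (γ (h τ)) u u • schoutenSharp g (γ (h τ)) u
          - (2 * schouten g (γ (h τ)) u u) • u) := by
    rintro _ _ _ rfl rfl rfl
    exact Iff.rfl
  rw [e _ _ _ (hh.velocity hc hτ) (hh.accel hc g hτ) (hh.covDeriv_accel hc g hτ), ← sub_eq_zero,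
    schoutenSharp_smul, schouten_smul_left, schouten_smul_right, obstruction]
  simp only [map_add, map_smul, add_apply, smul_apply, smul_eq_mul]
  rw [g.symm _ (ConformalCurves.accel g γ (h τ)) (ConformalCurves.velocity γ (h τ))]
  refine Eq.congr_left ?_
  generalize g.inner (γ (h τ)) (ConformalCurves.velocity γ (h τ))
    (ConformalCurves.velocity γ (h τ)) = q at *
  match_scalars <;> field_simp <;> ring

end IsReparametrization

lemma IsSmoothCurve.contDiffOn_inv_metric_velocity (hc : IsSmoothCurve n γ J) (g : Metric n M)
    (hreg : ∀ t ∈ J, velocity (n := n) γ t ≠ 0) :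
    ContDiffOn ℝ ∞ (fun t => (g.inner (γ t) (velocity γ t) (velocity γ t))⁻¹) J :=
  (hc.contDiffOn_metric g hc.isSmoothAlong_velocity hc.isSmoothAlong_velocity).inv
    fun t ht => (g.pos (γ t) _ (hreg t ht)).ne'

/-- By `solves_iff` a solution forces the obstruction to be tangent, on dividing by `h'³`.
Conversely, tangency reduces the vector equation to the scalar equation of
`exists_reparametrization`. -/
theorem isConformalCircle_iff_isTangential (hc : IsSmoothCurve n γ J) (g : Metric n M)
    (hreg : ∀ t ∈ J, velocity (n := n) γ t ≠ 0) :
    IsConformalCircle g γ J ↔ IsTangential g γ J := by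
  constructor
  · intro H t₀ ht₀
    obtain ⟨K, h, hK, -, hsm, hne, hm, ⟨τ, hτ, rfl⟩, hs⟩ := H t₀ ht₀
    have s1 : ContDiffOn ℝ ∞ (deriv h) K := hsm.deriv_of_isOpen hK (by simp)
    have s2 : ContDiffOn ℝ ∞ (deriv (deriv h)) K := s1.deriv_of_isOpen hK (by simp)
    have hd : ∀ f : ℝ → ℝ, ContDiffOn ℝ ∞ f K → ∀ τ ∈ K, HasDerivAt f (deriv f τ) τ :=
      fun f hf τ hτ => ((hf.contDiffAt (hK.mem_nhds hτ)).differentiableAt (by simp)).hasDerivAt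
    have hh : IsReparametrization J K h (deriv h) (deriv (deriv h)) (deriv (deriv (deriv h))) :=
      ⟨hK, hsm, hm, hne, hd _ hsm, hd _ s1, hd _ s2⟩
    have e := (hh.solves_iff hc hreg g hτ).1 (hs τ hτ)
    rw [add_eq_zero_iff_eq_neg, ← neg_smul] at e
    exact ⟨_, by rw [← smul_smul, ← e, smul_smul, inv_mul_cancel₀ (pow_ne_zero 3 (hne τ hτ)),
      one_smul]⟩
  · intro H t₀ ht₀
    have hU := hc.isSmoothAlong_velocity (n := n)
    have hA := hc.isSmoothAlong_accel g
    have hA' := hc.isSmoothAlong_covDeriv g hA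
    have hq := hc.contDiffOn_inv_metric_velocity g hreg
    have hq' := hc.contDiffOn_metric g hU hU
    -- Tangency only provides a factor at each point separately. Pairing the obstruction with the
    -- velocity recovers it as a smooth function, as the differential equation requires.
    set ν : ℝ → ℝ := fun t => (g.inner (γ t) (velocity γ t) (velocity γ t))⁻¹ *
      (g.inner (γ t) (covDeriv g γ (accel g γ) t) (velocity γ t)
        - 3 * (g.inner (γ t) (velocity γ t) (velocity γ t))⁻¹
          * g.inner (γ t) (velocity γ t) (accel g γ t) * g.inner (γ t) (accel g γ t) (velocity γ t)
        - g.inner (γ t) (velocity γ t) (velocity γ t) *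
          schouten g (γ t) (velocity γ t) (velocity γ t)) with hν
    have sν : ContDiffOn ℝ ∞ ν J :=
      hq.mul (((hc.contDiffOn_metric g hA' hU).sub (((contDiffOn_const.mul hq).mul
        (hc.contDiffOn_metric g hU hA)).mul (hc.contDiffOn_metric g hA hU))).sub
        (hq'.mul (hc.contDiffOn_schouten g hU hU)))
    have eν : ∀ t ∈ J, obstruction g γ t = ν t • velocity γ t := by
      intro t ht
      obtain ⟨k, hk⟩ := H t ht
      have e1 : g.inner (γ t) (obstruction g γ t) (velocity γ t) =
          k * g.inner (γ t) (velocity γ t) (velocity γ t) := by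
        rw [hk, map_smul, smul_apply, smul_eq_mul]
      have e2 : ν t = k := by
        rw [obstruction] at e1
        simp only [map_sub, map_smul, sub_apply, smul_apply, smul_eq_mul,
          metric_schoutenSharp] at e1
        rw [hν]
        simp only [e1]
        rw [mul_comm k, inv_mul_cancel_left₀ (g.pos (γ t) _ (hreg t ht)).ne']
      rw [e2, hk]
    have sF : ContDiffOn ℝ ∞ (fun t => ν t + (3 / 2 * (g.inner (γ t) (velocity γ t)
        (velocity γ t))⁻¹ * g.inner (γ t) (accel g γ t) (accel g γ t)
        + 2 * schouten g (γ t) (velocity γ t) (velocity γ t))) J :=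
      sν.add (((contDiffOn_const.mul hq).mul (hc.contDiffOn_metric g hA hA)).add
        (contDiffOn_const.mul (hc.contDiffOn_schouten g hU hU)))
    obtain ⟨K, h, h₁, h₂, hK, hKc, hsm, hm, hmem, hd⟩ := exists_reparametrization hc.isOpen sF ht₀
    have hh : IsReparametrization J K h h₁ h₂ _ :=
      ⟨hK, hsm, hm, fun τ hτ => (hd τ hτ).1, fun τ hτ => (hd τ hτ).2.1,
        fun τ hτ => (hd τ hτ).2.2.1, fun τ hτ => (hd τ hτ).2.2.2⟩
    refine ⟨K, h, hK, hKc, hsm, fun τ hτ => ?_, hm, hmem, fun τ hτ => ?_⟩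
    · rw [(hd τ hτ).2.1.deriv]
      exact (hd τ hτ).1
    · rw [hh.solves_iff hc hreg g hτ, eν _ (hm hτ)]
      module

end Reparametrization

/-! ### Tractors along the curve, vertices and the osculating bundle -/

section Tractors

set_option linter.unusedSectionVars false

variable {n : ℕ} {M : Type*} [TopologicalSpace M] [ChartedSpace (Model n) M]
  [IsManifold (𝓡 n) ∞ M] {γ : ℝ → M} {J : Set ℝ} {t : ℝ} {V W : ∀ t, Tractor n (γ t)}

lemma tractorDeriv_congr (hc : IsSmoothCurve n γ J) (g : Metric n M) (h : ∀ t ∈ J, V t = W t)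
    (ht : t ∈ J) : tractorDeriv g γ V t = tractorDeriv g γ W t := by
  have e1 : deriv (fun s => (V s).1) t = deriv (fun s => (W s).1) t := by
    refine Filter.EventuallyEq.deriv_eq ?_
    filter_upwards [hc.isOpen.mem_nhds ht] with s hs
    rw [h s hs]
  have e2 : deriv (fun s => (V s).2.2) t = deriv (fun s => (W s).2.2) t := by
    refine Filter.EventuallyEq.deriv_eq ?_
    filter_upwards [hc.isOpen.mem_nhds ht] with s hs
    rw [h s hs]
  have e3 : covDeriv g γ (fun s => (V s).2.1) t = covDeriv g γ (fun s => (W s).2.1) t :=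
    hc.covDeriv_congr g (fun s hs => by rw [h s hs]) ht
  rw [tractorDeriv, tractorDeriv, e1, e2, e3, h t ht]

lemma IsSmoothTractorAlong.congr (hV : IsSmoothTractorAlong γ J V) (h : ∀ t ∈ J, W t = V t) :
    IsSmoothTractorAlong γ J W :=
  ⟨hV.1.congr fun t ht => by rw [h t ht],
    IsSmoothCurve.isSmoothAlong_congr hV.2.1 fun t ht => by rw [h t ht],
    hV.2.2.congr fun t ht => by rw [h t ht]⟩

lemma IsSmoothTractorAlong.add (hc : IsSmoothCurve n γ J) (hV : IsSmoothTractorAlong γ J V)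
    (hW : IsSmoothTractorAlong γ J W) : IsSmoothTractorAlong γ J (fun t => V t + W t) :=
  ⟨hV.1.add hW.1, hc.isSmoothAlong_add hV.2.1 hW.2.1, hV.2.2.add hW.2.2⟩

lemma IsSmoothTractorAlong.smul (hc : IsSmoothCurve n γ J) {f : ℝ → ℝ} (hf : ContDiffOn ℝ ∞ f J)
    (hV : IsSmoothTractorAlong γ J V) : IsSmoothTractorAlong γ J (fun t => f t • V t) :=
  ⟨hf.mul hV.1, hc.isSmoothAlong_smul hf hV.2.1, hf.mul hV.2.2⟩

lemma IsSmoothCurve.hasDerivAt (hc : IsSmoothCurve n γ J) {f : ℝ → ℝ} (hf : ContDiffOn ℝ ∞ f J)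
    (ht : t ∈ J) : HasDerivAt f (deriv f t) t :=
  ((hf.contDiffAt (hc.isOpen.mem_nhds ht)).differentiableAt (by simp)).hasDerivAt

lemma tractorDeriv_add (hc : IsSmoothCurve n γ J) (g : Metric n M)
    (hV : IsSmoothTractorAlong γ J V) (hW : IsSmoothTractorAlong γ J W) (ht : t ∈ J) :
    tractorDeriv g γ (fun t => V t + W t) t = tractorDeriv g γ V t + tractorDeriv g γ W t := by
  have e1 := ((hc.hasDerivAt hV.1 ht).fun_add (hc.hasDerivAt hW.1 ht)).deriv
  have e2 := ((hc.hasDerivAt hV.2.2 ht).fun_add (hc.hasDerivAt hW.2.2 ht)).deriv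
  have e3 := hc.covDeriv_add g hV.2.1 hW.2.1 ht
  simp only [tractorDeriv, Prod.fst_add, Prod.snd_add, Prod.mk_add_mk, Prod.mk.injEq, e1, e2, e3,
    map_add, schouten_add_right]
  refine ⟨by ring, by module, by ring⟩

lemma tractorDeriv_smul (hc : IsSmoothCurve n γ J) (g : Metric n M) {f : ℝ → ℝ}
    (hf : ContDiffOn ℝ ∞ f J) (hV : IsSmoothTractorAlong γ J V) (ht : t ∈ J) :
    tractorDeriv g γ (fun t => f t • V t) t = deriv f t • V t + f t • tractorDeriv g γ V t := by
  have e1 := ((hc.hasDerivAt hf ht).fun_mul (hc.hasDerivAt hV.1 ht)).deriv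
  have e2 := ((hc.hasDerivAt hf ht).fun_mul (hc.hasDerivAt hV.2.2 ht)).deriv
  have e3 := hc.covDeriv_smul g hf hV.2.1 ht
  ext1
  · simp only [tractorDeriv, Prod.smul_fst, Prod.smul_snd, Prod.fst_add, smul_eq_mul, e1, map_smul]
    ring
  ext1
  · simp only [tractorDeriv, Prod.smul_fst, Prod.smul_snd, Prod.fst_add, Prod.snd_add, smul_eq_mul,
      e3]
    module
  · simp only [tractorDeriv, Prod.smul_fst, Prod.smul_snd, Prod.snd_add, smul_eq_mul, e2,
      schouten_smul_right]
    ring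

/-- The inverse speed `u⁻¹`. -/
def invSpeed (g : Metric n M) (γ : ℝ → M) (t : ℝ) : ℝ :=
  (√(g.inner (γ t) (velocity γ t) (velocity γ t)))⁻¹

/-- The last component of the tractor `U'`. -/
def tractorRho (g : Metric n M) (γ : ℝ → M) (t : ℝ) : ℝ :=
  deriv (deriv (invSpeed g γ)) t - invSpeed g γ t * schouten g (γ t) (velocity γ t) (velocity γ t)

lemma tractorT_eq (g : Metric n M) : tractorT g γ t = (0, 0, invSpeed g γ t) := rfl

lemma mem_osculatingSpan {g : Metric n M} {x : Tractor n (γ t)} : x ∈ osculatingSpan g γ t ↔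
    ∃ a b c : ℝ, a • tractorT g γ t + b • tractorU g γ 0 t + c • tractorU g γ 1 t = x :=
  Submodule.mem_span_triple

section

variable (hc : IsSmoothCurve n γ J) (g : Metric n M) (hreg : ∀ t ∈ J, velocity (n := n) γ t ≠ 0)
include hc hreg

lemma invSpeed_pos (ht : t ∈ J) : 0 < invSpeed g γ t :=
  inv_pos.2 (Real.sqrt_pos.2 (g.pos _ _ (hreg t ht)))

lemma invSpeed_sq (ht : t ∈ J) :
    invSpeed g γ t ^ 2 * g.inner (γ t) (velocity γ t) (velocity γ t) = 1 := by
  have h := g.pos _ _ (hreg t ht)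
  rw [invSpeed, inv_pow, Real.sq_sqrt h.le, inv_mul_cancel₀ h.ne']

lemma contDiffOn_invSpeed : ContDiffOn ℝ ∞ (invSpeed g γ) J := by
  have h1 := hc.contDiffOn_metric g (hc.isSmoothAlong_velocity (n := n)) hc.isSmoothAlong_velocity
  exact (h1.sqrt fun t ht => (g.pos _ _ (hreg t ht)).ne').inv
    fun t ht => (Real.sqrt_pos.2 (g.pos _ _ (hreg t ht))).ne'

lemma contDiffOn_deriv_invSpeed : ContDiffOn ℝ ∞ (deriv (invSpeed g γ)) J :=
  (contDiffOn_invSpeed hc g hreg).deriv_of_isOpen hc.isOpen (by simp)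

lemma contDiffOn_deriv_deriv_invSpeed : ContDiffOn ℝ ∞ (deriv (deriv (invSpeed g γ))) J :=
  (contDiffOn_deriv_invSpeed hc g hreg).deriv_of_isOpen hc.isOpen (by simp)

lemma hasDerivAt_metric_velocity (ht : t ∈ J) :
    HasDerivAt (fun t => g.inner (γ t) (velocity γ t) (velocity γ t))
      (2 * g.inner (γ t) (velocity γ t) (accel g γ t)) t := by
  have h := hc.hasDerivAt_metric g (hc.isSmoothAlong_velocity (n := n)) hc.isSmoothAlong_velocity ht
  refine h.congr_deriv ?_
  rw [g.symm _ (covDeriv g γ _ t), accel]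
  ring

/-- Comes from differentiating `u⁻²⟨U,U⟩ = 1`, which avoids differentiating the square root. -/
lemma deriv_invSpeed (ht : t ∈ J) : deriv (invSpeed g γ) t =
    -g.inner (γ t) (velocity γ t) (accel g γ t) * invSpeed g γ t ^ 3 := by
  have h1 := ((hc.hasDerivAt (contDiffOn_invSpeed hc g hreg) ht).fun_pow 2).fun_mul
    (hasDerivAt_metric_velocity hc g hreg ht)
  have h2 : HasDerivAt (fun t => invSpeed g γ t ^ 2 *
      g.inner (γ t) (velocity γ t) (velocity γ t)) 0 t :=
    (hasDerivAt_const t (1 : ℝ)).congr_of_eventuallyEq <| by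
      filter_upwards [hc.isOpen.mem_nhds ht] with s hs using invSpeed_sq hc g hreg hs
  have h3 := h1.unique h2
  have h4 := invSpeed_sq hc g hreg ht
  have h5 := (invSpeed_pos hc g hreg ht).ne'
  simp only [Nat.cast_ofNat, Nat.add_one_sub_one, pow_one] at h3
  apply mul_left_cancel₀ (two_ne_zero (α := ℝ))
  generalize g.inner (γ t) (velocity γ t) (velocity γ t) = q at *
  linear_combination (invSpeed g γ t) * h3 - 2 * deriv (invSpeed g γ) t * h4

lemma deriv_deriv_invSpeed (ht : t ∈ J) : deriv (deriv (invSpeed g γ)) t =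
    -(g.inner (γ t) (accel g γ t) (accel g γ t)
      + g.inner (γ t) (velocity γ t) (covDeriv g γ (accel g γ) t)) * invSpeed g γ t ^ 3
    + 3 * g.inner (γ t) (velocity γ t) (accel g γ t) ^ 2 * invSpeed g γ t ^ 5 := by
  have h1 := (hc.hasDerivAt_metric g (hc.isSmoothAlong_velocity (n := n))
    (hc.isSmoothAlong_accel g) ht).fun_neg.fun_mul
    ((hc.hasDerivAt (contDiffOn_invSpeed hc g hreg) ht).fun_pow 3)
  have h2 := h1.congr_of_eventuallyEq (f₁ := deriv (invSpeed g γ)) <| by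
    filter_upwards [hc.isOpen.mem_nhds ht] with s hs using deriv_invSpeed hc g hreg hs
  rw [h2.deriv, deriv_invSpeed hc g hreg ht, accel]
  simp only [Nat.cast_ofNat, Nat.add_one_sub_one]
  ring

lemma isSmoothTractorAlong_tractorT : IsSmoothTractorAlong γ J (tractorT g γ) := by
  refine ⟨contDiffOn_const, ?_, contDiffOn_invSpeed hc g hreg⟩
  -- The zero field is smooth as `0` times the velocity.
  exact IsSmoothCurve.isSmoothAlong_congr (hc.isSmoothAlong_smul (contDiffOn_const (c := (0 : ℝ)))
    (hc.isSmoothAlong_velocity (n := n))) fun t _ => (zero_smul ℝ _).symm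

lemma tractorU_zero (ht : t ∈ J) :
    tractorU g γ 0 t = (0, invSpeed g γ t • velocity γ t, deriv (invSpeed g γ) t) := by
  have e1 : covDeriv g γ (fun _ => 0) t = 0 := by
    have := hc.covDeriv_smul g (contDiffOn_const (c := (0 : ℝ)))
      (hc.isSmoothAlong_velocity (n := n)) ht
    simpa using this
  have e2 : schouten g (γ t) (velocity γ t) 0 = 0 := by
    have := schouten_smul_right g (γ t) 0 (velocity γ t) 0
    simpa using this
  have e3 : deriv (fun s => (tractorT (n := n) g γ s).2.2) t = deriv (invSpeed g γ) t := rfl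
  rw [tractorU, tractorDeriv, e3]
  simp only [tractorT_eq, e1, e2]
  simp

lemma contDiffOn_tractorRho : ContDiffOn ℝ ∞ (tractorRho g γ) J :=
  (contDiffOn_deriv_deriv_invSpeed hc g hreg).sub ((contDiffOn_invSpeed hc g hreg).mul
    (hc.contDiffOn_schouten g hc.isSmoothAlong_velocity hc.isSmoothAlong_velocity))

lemma isSmoothTractorAlong_tractorU_zero : IsSmoothTractorAlong γ J (tractorU g γ 0) :=
  IsSmoothTractorAlong.congr (V := fun t => (0, invSpeed g γ t • velocity γ t,
    deriv (invSpeed g γ) t)) ⟨contDiffOn_const,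
      hc.isSmoothAlong_smul (contDiffOn_invSpeed hc g hreg) hc.isSmoothAlong_velocity,
      contDiffOn_deriv_invSpeed hc g hreg⟩ fun _ ht => tractorU_zero hc g hreg ht

lemma tractorU_one (ht : t ∈ J) :
    tractorU g γ 1 t =
      (-(invSpeed g γ t * g.inner (γ t) (velocity γ t) (velocity γ t)),
        invSpeed g γ t • accel g γ t + (2 * deriv (invSpeed g γ) t) • velocity γ t,
        tractorRho g γ t) := by
  rw [tractorU, tractorDeriv_congr hc g (fun s hs => tractorU_zero hc g hreg hs) ht, tractorDeriv]
  simp only [hc.covDeriv_smul g (contDiffOn_invSpeed hc g hreg) hc.isSmoothAlong_velocity ht,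
    schouten_smul_right, map_smul, deriv_const, smul_eq_mul, tractorRho]
  refine Prod.ext (by simp) (Prod.ext ?_ rfl)
  simp only [accel]
  module

lemma isSmoothTractorAlong_tractorU_one : IsSmoothTractorAlong γ J (tractorU g γ 1) := by
  have hU := hc.isSmoothAlong_velocity (n := n)
  have hf := contDiffOn_invSpeed hc g hreg
  refine IsSmoothTractorAlong.congr ⟨?_, ?_, ?_⟩ fun _ ht => tractorU_one hc g hreg ht
  · exact (hf.mul (hc.contDiffOn_metric g hU hU)).neg
  · exact hc.isSmoothAlong_add (hc.isSmoothAlong_smul hf (hc.isSmoothAlong_accel g))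
      (hc.isSmoothAlong_smul (contDiffOn_const.mul (contDiffOn_deriv_invSpeed hc g hreg)) hU)
  · exact contDiffOn_tractorRho hc g hreg

/-- The derivative of `-u` cancels the pairing of `U` with the middle entry, so the first entry
vanishes. The last entry stays unspecified: the tractor metric pairs it with that zero, and within
the span a multiple of `T` absorbs it. -/
lemma tractorU_two (ht : t ∈ J) :
    ∃ ρ : ℝ, tractorU g γ 2 t = (0, invSpeed g γ t • obstruction g γ t
      + (2 * deriv (deriv (invSpeed g γ)) t + tractorRho g γ t) • velocity γ t, ρ) := by
  have hU := hc.isSmoothAlong_velocity (n := n)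
  have hA := hc.isSmoothAlong_accel g
  have hf := contDiffOn_invSpeed hc g hreg
  have hf1 := contDiffOn_deriv_invSpeed hc g hreg
  have hf2 : ContDiffOn ℝ ∞ (fun t => 2 * deriv (invSpeed g γ) t) J := contDiffOn_const.mul hf1
  have h4 := invSpeed_sq hc g hreg ht
  have e0 : tractorU g γ 2 t = _ :=
    (tractorDeriv_congr hc g (fun s hs => tractorU_one hc g hreg hs) ht).trans rfl
  refine ⟨(tractorU g γ 2 t).2.2, Prod.ext ?_ (Prod.ext ?_ rfl)⟩ <;> rw [e0, tractorDeriv]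
  · have e := ((hc.hasDerivAt hf ht).fun_mul
      (hasDerivAt_metric_velocity hc g hreg ht)).fun_neg.deriv
    simp only [e, map_add, map_smul, smul_eq_mul, deriv_invSpeed hc g hreg ht]
    generalize g.inner (γ t) (velocity γ t) (velocity γ t) = q at *
    linear_combination (3 * g.inner (γ t) (velocity γ t) (accel g γ t) * invSpeed g γ t) * h4
  · have e2 : deriv (fun t => 2 * deriv (invSpeed g γ) t) t =
        2 * deriv (deriv (invSpeed g γ)) t := ((hc.hasDerivAt hf1 ht).const_mul 2).deriv
    have e3 : (g.inner (γ t) (velocity γ t) (velocity γ t))⁻¹ = invSpeed g γ t ^ 2 :=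
      (eq_inv_of_mul_eq_one_left h4).symm
    simp only [hc.covDeriv_add g (hc.isSmoothAlong_smul hf hA) (hc.isSmoothAlong_smul hf2 hU) ht,
      hc.covDeriv_smul g hf hA ht, hc.covDeriv_smul g hf2 hU ht, e2, obstruction, e3,
      deriv_invSpeed hc g hreg ht]
    simp only [accel]
    module

/-- `Φ` is the squared length of the normal part of the obstruction, up to a positive factor. -/
lemma Phi_eq (ht : t ∈ J) : Phi g γ t = invSpeed g γ t ^ 2 *
    g.inner (γ t)
      (obstruction g γ t - (invSpeed g γ t ^ 2 * g.inner (γ t) (obstruction g γ t) (velocity γ t)) •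
        velocity γ t)
      (obstruction g γ t - (invSpeed g γ t ^ 2 * g.inner (γ t) (obstruction g γ t) (velocity γ t)) •
        velocity γ t) := by
  obtain ⟨ρ, hρ⟩ := tractorU_two hc g hreg ht
  have h4 := invSpeed_sq hc g hreg ht
  have e3 : (g.inner (γ t) (velocity γ t) (velocity γ t))⁻¹ = invSpeed g γ t ^ 2 :=
    (eq_inv_of_mul_eq_one_left h4).symm
  have e4 : g.inner (γ t) (obstruction g γ t) (velocity γ t) =
      g.inner (γ t) (velocity γ t) (covDeriv g γ (accel g γ) t)
      - 3 * invSpeed g γ t ^ 2 * g.inner (γ t) (velocity γ t) (accel g γ t) ^ 2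
      - g.inner (γ t) (velocity γ t) (velocity γ t) *
        schouten g (γ t) (velocity γ t) (velocity γ t) := by
    rw [obstruction, e3]
    simp only [map_sub, map_smul, sub_apply, smul_apply, smul_eq_mul, metric_schoutenSharp]
    rw [g.symm _ _ (velocity γ t), g.symm _ (accel g γ t) (velocity γ t)]
    ring
  -- This is the identity ⟨U',U'⟩ = -⟨U'',U⟩, checked by direct computation. The middle entry of `U`
  -- is a unit vector, so the square is the squared tangential part of the middle entry of `U''`.
  have e5 : tractorMetric g (γ t) (tractorU g γ 1 t) (tractorU g γ 1 t) =
      -(invSpeed g γ t * (invSpeed g γ t * g.inner (γ t) (obstruction g γ t) (velocity γ t)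
        + (2 * deriv (deriv (invSpeed g γ)) t + tractorRho g γ t) *
          g.inner (γ t) (velocity γ t) (velocity γ t))) := by
    rw [tractorU_one hc g hreg ht, tractorMetric, e4]
    simp only [map_add, map_smul, add_apply, smul_apply, smul_eq_mul, tractorRho,
      deriv_deriv_invSpeed hc g hreg ht, deriv_invSpeed hc g hreg ht]
    rw [g.symm _ (accel g γ t) (velocity γ t)]
    generalize g.inner (γ t) (velocity γ t) (velocity γ t) = q at *
    generalize g.inner (γ t) (velocity γ t) (accel g γ t) = a at *
    generalize g.inner (γ t) (accel g γ t) (accel g γ t) = b at *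
    generalize g.inner (γ t) (velocity γ t) (covDeriv g γ (accel g γ) t) = c at *
    generalize invSpeed g γ t = f at *
    have hqf : q = (f ^ 2)⁻¹ := eq_inv_of_mul_eq_one_right h4
    have hf : f ≠ 0 := fun h0 => by simp [h0] at h4
    subst hqf
    field_simp
    ring
  rw [Phi, e5, hρ, tractorMetric]
  simp only [map_add, map_sub, map_smul, add_apply, sub_apply, smul_apply, smul_eq_mul]
  rw [g.symm _ (velocity γ t) (obstruction g γ t)]
  generalize g.inner (γ t) (velocity γ t) (velocity γ t) = q at *
  generalize invSpeed g γ t = f at *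
  have hqf : q = (f ^ 2)⁻¹ := eq_inv_of_mul_eq_one_right h4
  have hf : f ≠ 0 := fun h0 => by simp [h0] at h4
  subst hqf
  field_simp
  ring

theorem Phi_eq_zero_iff : (∀ t ∈ J, Phi g γ t = 0) ↔ IsTangential g γ J := by
  refine forall₂_congr fun t ht => ?_
  have hf := (invSpeed_pos hc g hreg ht).ne'
  have h4 := invSpeed_sq hc g hreg ht
  rw [Phi_eq hc g hreg ht]
  constructor
  · intro h
    refine ⟨invSpeed g γ t ^ 2 * g.inner (γ t) (obstruction g γ t) (velocity γ t),
      sub_eq_zero.1 ?_⟩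
    by_contra hne
    exact (mul_ne_zero (pow_ne_zero 2 hf) (g.pos _ _ hne).ne') h
  · rintro ⟨k, hk⟩
    have e : invSpeed g γ t ^ 2 * g.inner (γ t) (obstruction g γ t) (velocity γ t) = k := by
      rw [hk, map_smul, smul_apply, smul_eq_mul]
      linear_combination k * h4
    rw [e, hk, sub_self, map_zero, mul_zero]

/-- The three tractors are triangular with respect to the slots `(σ, μ, ρ)`, with nonzero leading
entries `u⁻¹`, `u⁻¹U` and `-u`. -/
lemma finrank_osculatingSpan (ht : t ∈ J) : Module.finrank ℝ (osculatingSpan g γ t) = 3 := by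
  have hf := (invSpeed_pos hc g hreg ht).ne'
  have hq := (g.pos _ _ (hreg t ht)).ne'
  have hU := hreg t ht
  have hli : LinearIndependent ℝ ![tractorT g γ t, tractorU g γ 0 t, tractorU g γ 1 t] := by
    rw [Fintype.linearIndependent_iff]
    intro c hsum
    rw [Fin.sum_univ_three] at hsum
    simp only [Matrix.cons_val_zero, Matrix.cons_val_one, Matrix.cons_val, tractorT_eq,
      tractorU_zero hc g hreg ht, tractorU_one hc g hreg ht] at hsum
    have s1 := congrArg (fun x => x.1) hsum
    have s2 := congrArg (fun x => x.2.1) hsum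
    have s3 := congrArg (fun x => x.2.2) hsum
    have c2 : c 2 = 0 := by simpa [hf, hq] using s1
    have c1 : c 1 = 0 := by simpa [c2, hf, hU] using s2
    have c0 : c 0 = 0 := by simpa [c1, c2, hf] using s3
    intro i
    fin_cases i <;> assumption
  have e : ({tractorT g γ t, tractorU g γ 0 t, tractorU g γ 1 t} : Set (Tractor n (γ t))) =
      range ![tractorT g γ t, tractorU g γ 0 t, tractorU g γ 1 t] := by
    rw [Matrix.range_cons, Matrix.range_cons, Matrix.range_cons_empty]
    rfl
  rw [osculatingSpan, e, finrank_span_eq_card hli]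
  simp

/-- The derivatives of `T` and `U` lie in the span by construction, so everything hinges on the
derivative of `U'`, given by `tractorU_two`. -/
theorem osculatingBundleIsParallel_iff :
    OsculatingBundleIsParallel g γ J ↔ IsTangential g γ J := by
  constructor
  · rintro ⟨-, H⟩ t ht
    have h1 := H _ (isSmoothTractorAlong_tractorU_one hc g hreg)
      (fun t _ => Submodule.subset_span (by simp)) t ht
    obtain ⟨ρ, hρ⟩ := tractorU_two hc g hreg ht
    rw [show tractorDeriv g γ (tractorU g γ 1) t = tractorU g γ 2 t from rfl, hρ,
      mem_osculatingSpan, tractorT_eq, tractorU_zero hc g hreg ht,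
      tractorU_one hc g hreg ht] at h1
    obtain ⟨a, b, c, h⟩ := h1
    have hf := (invSpeed_pos hc g hreg ht).ne'
    have hq := (g.pos _ _ (hreg t ht)).ne'
    have s1 := congrArg (fun x => x.1) h
    have s2 := congrArg (fun x => x.2.1) h
    have hc0 : c = 0 := by simpa [hf, hq] using s1
    simp only [hc0, Prod.smul_mk, Prod.mk_add_mk, smul_zero, zero_smul, zero_add, add_zero] at s2
    refine ⟨(invSpeed g γ t)⁻¹ * (b * invSpeed g γ t
      - (2 * deriv (deriv (invSpeed g γ)) t + tractorRho g γ t)), ?_⟩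
    rw [← smul_smul, sub_smul, ← smul_smul, s2, add_sub_cancel_right, smul_smul,
      inv_mul_cancel₀ hf, one_smul]
  · intro H
    refine ⟨fun t ht => finrank_osculatingSpan hc g hreg ht, fun W hW hmem t ht => ?_⟩
    have hU := hc.isSmoothAlong_velocity (n := n)
    have hf := contDiffOn_invSpeed hc g hreg
    have hqs := hc.contDiffOn_metric g hU hU
    have hT := isSmoothTractorAlong_tractorT hc g hreg
    have hU0 := isSmoothTractorAlong_tractorU_zero hc g hreg
    have hU1 := isSmoothTractorAlong_tractorU_one hc g hreg
    -- The coefficients of `W` are solved for slot by slot: `c` from the first entry, `b` by pairing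
    -- the middle one with the velocity, `a` from the last. These formulas make them smooth, so the
    -- Leibniz rule applies.
    set c : ℝ → ℝ := fun t => -((W t).1 * invSpeed g γ t)
    have sc : ContDiffOn ℝ ∞ c J := (hW.1.mul hf).neg
    set b : ℝ → ℝ := fun t => invSpeed g γ t * (g.inner (γ t) ((W t).2.1) (velocity γ t)
      - c t * g.inner (γ t) ((tractorU g γ 1 t).2.1) (velocity γ t))
    have sb : ContDiffOn ℝ ∞ b J := hf.mul ((hc.contDiffOn_metric g hW.2.1 hU).sub
      (sc.mul (hc.contDiffOn_metric g hU1.2.1 hU)))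
    set a : ℝ → ℝ := fun t => invSpeed g γ t * g.inner (γ t) (velocity γ t) (velocity γ t) *
      ((W t).2.2 - b t * (tractorU g γ 0 t).2.2 - c t * (tractorU g γ 1 t).2.2)
    have sa : ContDiffOn ℝ ∞ a J := (hf.mul hqs).mul ((hW.2.2.sub (sb.mul hU0.2.2)).sub
      (sc.mul hU1.2.2))
    have hWeq : ∀ t ∈ J, W t = a t • tractorT g γ t + b t • tractorU g γ 0 t
        + c t • tractorU g γ 1 t := by
      intro t ht
      obtain ⟨a', b', c', h⟩ := (mem_osculatingSpan).1 (hmem t ht)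
      have h4 := invSpeed_sq hc g hreg ht
      have ec : c t = c' := by
        rw [show c t = -((W t).1 * invSpeed g γ t) from rfl, ← h]
        simp only [tractorT_eq, tractorU_zero hc g hreg ht, tractorU_one hc g hreg ht,
          Prod.smul_mk, Prod.mk_add_mk, smul_eq_mul]
        linear_combination c' * h4
      have eb : b t = b' := by
        rw [show b t = invSpeed g γ t * (g.inner (γ t) ((W t).2.1) (velocity γ t)
          - c t * g.inner (γ t) ((tractorU g γ 1 t).2.1) (velocity γ t)) from rfl, ec, ← h]
        simp only [tractorT_eq, tractorU_zero hc g hreg ht, Prod.smul_snd, Prod.snd_add,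
          Prod.fst_add, Prod.smul_fst, map_add, map_smul, add_apply, smul_apply, smul_eq_mul,
          smul_zero, map_zero, zero_apply]
        linear_combination b' * h4
      have ea : a t = a' := by
        rw [show a t = invSpeed g γ t * g.inner (γ t) (velocity γ t) (velocity γ t) *
          ((W t).2.2 - b t * (tractorU g γ 0 t).2.2 - c t * (tractorU g γ 1 t).2.2) from rfl,
          ec, eb, ← h]
        simp only [tractorT_eq, Prod.smul_snd, Prod.snd_add, smul_eq_mul]
        linear_combination a' * h4
      rw [ea, eb, ec, h]
    have hTD : tractorDeriv g γ (tractorT g γ) t ∈ osculatingSpan g γ t :=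
      Submodule.subset_span (by simp [tractorU])
    have hU0D : tractorDeriv g γ (tractorU g γ 0) t ∈ osculatingSpan g γ t :=
      Submodule.subset_span (by simp [tractorU])
    have mT : tractorT g γ t ∈ osculatingSpan g γ t := Submodule.subset_span (by simp)
    have mU0 : tractorU g γ 0 t ∈ osculatingSpan g γ t := Submodule.subset_span (by simp)
    have mU1 : tractorU g γ 1 t ∈ osculatingSpan g γ t := Submodule.subset_span (by simp)
    have hU1D : tractorDeriv g γ (tractorU g γ 1) t ∈ osculatingSpan g γ t := by
      obtain ⟨ρ, hρ⟩ := tractorU_two hc g hreg ht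
      obtain ⟨k, hk⟩ := H t ht
      have h5 := (invSpeed_pos hc g hreg ht).ne'
      rw [show tractorDeriv g γ (tractorU g γ 1) t = tractorU g γ 2 t from rfl, hρ,
        mem_osculatingSpan, tractorT_eq, tractorU_zero hc g hreg ht, hk]
      -- `l` matches the middle slot with a multiple of `U`; the multiple of `T` then corrects the
      -- last slot.
      set l := k + (invSpeed g γ t)⁻¹ * (2 * deriv (deriv (invSpeed g γ)) t + tractorRho g γ t)
        with hl
      refine ⟨(invSpeed g γ t)⁻¹ * (ρ - l * deriv (invSpeed g γ) t), l, 0, ?_⟩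
      rw [zero_smul, add_zero]
      refine Prod.ext (by simp) (Prod.ext ?_ ?_)
      · simp only [Prod.smul_mk, Prod.mk_add_mk, smul_zero, zero_add, hl]
        match_scalars
        field_simp
      · simp only [Prod.smul_mk, Prod.mk_add_mk, smul_eq_mul]
        field_simp
        ring
    rw [tractorDeriv_congr hc g hWeq ht,
      tractorDeriv_add hc g ((hT.smul hc sa).add hc (hU0.smul hc sb)) (hU1.smul hc sc) ht,
      tractorDeriv_add hc g (hT.smul hc sa) (hU0.smul hc sb) ht, tractorDeriv_smul hc g sa hT ht,
      tractorDeriv_smul hc g sb hU0 ht, tractorDeriv_smul hc g sc hU1 ht]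
    exact add_mem (add_mem (add_mem (Submodule.smul_mem _ _ mT) (Submodule.smul_mem _ _ hTD))
      (add_mem (Submodule.smul_mem _ _ mU0) (Submodule.smul_mem _ _ hU0D)))
      (add_mem (Submodule.smul_mem _ _ mU1) (Submodule.smul_mem _ _ hU1D))

end

end Tractors

end ConformalCurves

end

theorem mainTheorem4 {n : ℕ} (hn : 3 ≤ n) {M : Type*} [TopologicalSpace M]
    [ChartedSpace (ConformalCurves.Model n) M] [IsManifold (𝓡 n) ∞ M]
    (c : ConformalCurves.ConformalStructure n M)
    (J : Set ℝ) (hJ : IsOpen J) (hJc : J.OrdConnected)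
    (γ : ℝ → M) (hγ : ContMDiffOn 𝓘(ℝ, ℝ) (𝓡 n) ∞ γ J)
    (hreg : ∀ t ∈ J, ConformalCurves.velocity (n := n) γ t ≠ 0)
    (g₁ g₂ g₃ : ConformalCurves.Metric n M)
    (hg₁ : g₁ ∈ c.metrics) (hg₂ : g₂ ∈ c.metrics) (hg₃ : g₃ ∈ c.metrics) :
    List.TFAE
      [ConformalCurves.IsConformalCircle g₁ γ J,
        ∀ t ∈ J, ConformalCurves.Phi g₂ γ t = 0,
        ConformalCurves.OsculatingBundleIsParallel g₃ γ J] := by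
  have hc : ConformalCurves.IsSmoothCurve n γ J := ⟨hJ, hγ⟩
  rw [ConformalCurves.isConformalCircle_iff_isTangential hc g₁ hreg,
    ConformalCurves.Phi_eq_zero_iff hc g₂ hreg,
    ConformalCurves.osculatingBundleIsParallel_iff hc g₃ hreg]
  -- Each condition is now tangency of the obstruction in its own metric, and tangency passes
  -- between any two metrics of the class.
  have key : ∀ g ∈ c.metrics, ∀ g' ∈ c.metrics, ConformalCurves.IsTangential g γ J →
      ConformalCurves.IsTangential g' γ J := fun g hg g' hg' =>
    ConformalCurves.IsTangential.of_isConformalTo ((c.mem_iff g hg g').1 hg') hn hc hreg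
  tfae_have 1 → 2 := key g₁ hg₁ g₂ hg₂
  tfae_have 2 → 3 := key g₂ hg₂ g₃ hg₃
  tfae_have 3 → 1 := key g₃ hg₃ g₁ hg₁
  tfae_finish
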